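/- Fix $k\ge 2$; all local Hilbert spaces are finite-dimensional and logarithms are to base 2. An LOCC protocol is a finite-round protocol of local measurements (with finitely many outcomes) and classical communication; it transforms $\psi$ into a unit vector $\varphi$ with probability $p$ if, summing over the branches declared successful, the subnormalised output state is $p|\varphi\rangle\langle\varphi|$. For unit vectors $\psi,\varphi$ and $R,r\ge 0$, the pair $(R,r)$ is achievable if there is a sequence of LOCC protocols transforming $\psi^{\otimes n}$ into $\varphi^{\otimes (Rn+o(n))}$ with probability at least $2^{-rn+o(n)}$. A spectral point with exponent $\alpha\in[0,1]$ is a functional $F\ge 0$ on (unnormalised) $k$-partite vectors, invariant under local isometries, with $F(\sqrt{t}\,\psi)=t^\alpha F(\psi)$ for $t>0$, $F(\langle r\rangle)=r$ for the rank-$r$ unit tensor $\langle r\rangle=\sum_{a=1}^r|a\rangle\otimes\dots\otimes|a\rangle$, $F(\psi\otimes\varphi)=F(\psi)F(\varphi)$, $F(\psi\oplus\varphi)=F(\psi)+F(\varphi)$, and $F(\psi)^{1/\alpha}\ge F(\Pi\psi)^{1/\alpha}+F((I-\Pi)\psi)^{1/\alpha}$ for every orthogonal projection $\Pi$ acting on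 a single tensor factor (for $\alpha=0$: $F(\psi)\ge\max\{F(\Pi\psi),F((I-\Pi)\psi)\}$). For $\alpha\in[0,1)$, $E=\frac{1}{1-\alpha}\log F$ (on nonzero vectors) is then called a logarithmic spectral point of order $\alpha$; a logarithmic spectral point of order $1$ is a functional on unit vectors that is a pointwise limit (of a net) of logarithmic spectral points of orders $\alpha\in(0,1)$ with $\alpha\to1$. Let $d(q\|p)=q\log\frac{q}{p}+(1-q)\log\frac{1-q}{1-p}$, with $0\log0=0$ and $0\log\frac00=0$. Let $\psi,\varphi$ be normalised $k$-partite state vectors, $m,n\in\mathbb{N}$, $n\ge1$, $p\in[0,1]$, and suppose that an LOCC protocol transforms $\psi^{\otimes n}$ into $\varphi^{\otimes m}$ with probability $p$. Then: (1) For every $q\in[0,1]$ with $d(\max\{p,q\}\|p)<\infty$ (that is, $p>0$ or $q=0$), the pair $$(R,r)=\left(q\frac{m}{n},\ \frac1n\, d(\max\{p,q\}\|p)\right)$$ is achievable. (2) For every $\alpha\in(0,1)$ and every logarithmic spectral point $E$ of order $\alpha$, $$E(\psi)\ge\frac1n\frac{\alpha}{1-\alpha}\log\left[p\,2^{m\frac{1-\alpha}{\alpha}E(\varphi)}+(1-p)\right].$$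 (3) If $p>0$, then every logarithmic spectral point $E$ of order $0$ satisfies $E(\psi)\ge\frac mn E(\varphi)$. (4) Every logarithmic spectral point $E$ of order $1$ satisfies $E(\psi)\ge p\frac mn E(\varphi)$. -/

import Mathlib

open scoped Matrix

namespace LOCCSpectrum

noncomputable section

/-- A `k`-partite quantum system with finite-dimensional local Hilbert spaces.  The Hilbert space of
party `i` is `ℂ^(idx i)`, with its standard orthonormal basis indexed by the finite set `idx i`. -/
structure Sys (k : ℕ) where
  idx : Fin k → Type
  [fin : ∀ i, Fintype (idx i)]
  [dec : ∀ i, DecidableEq (idx i)]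

attribute [instance] Sys.fin Sys.dec

variable {k : ℕ}

/-- The joint Hilbert space `⨂ᵢ ℂ^(idx i)`, in coordinates with respect to the product basis. -/
abbrev Sys.H (S : Sys k) : Type := EuclideanSpace ℂ (∀ i, S.idx i)

/-- `k`-partite tensor product: party `i` holds `ℂ^(S.idx i) ⊗ ℂ^(T.idx i)`. -/
abbrev Sys.tensor (S T : Sys k) : Sys k where
  idx i := S.idx i × T.idx i

/-- `k`-partite direct sum: party `i` holds `ℂ^(S.idx i) ⊕ ℂ^(T.idx i)`. -/
abbrev Sys.sum (S T : Sys k) : Sys k where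
  idx i := S.idx i ⊕ T.idx i

/-- `n` copies of a system: party `i` holds `(ℂ^(S.idx i))^{⊗ n}`. -/
abbrev Sys.pow (S : Sys k) (n : ℕ) : Sys k where
  idx i := Fin n → S.idx i

/-- The system in which every party holds `ℂ^r`. -/
abbrev Sys.diag (k r : ℕ) : Sys k where
  idx _ := Fin r

/-- The vector `ψ ⊗ φ`. -/
def tensorVec {S T : Sys k} (ψ : S.H) (φ : T.H) : (S.tensor T).H :=
  WithLp.toLp 2 fun x => ψ (fun i => (x i).1) * φ (fun i => (x i).2)

/-- The vector `ψ ⊕ φ`, with `ψ` on the all-left and `φ` on the all-right summand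
of `⨂ᵢ (ℂ^(S.idx i) ⊕ ℂ^(T.idx i))`. -/
def sumVec {S T : Sys k} (ψ : S.H) (φ : T.H) : (S.sum T).H :=
  WithLp.toLp 2 fun x : ∀ i, S.idx i ⊕ T.idx i =>
    (∑ a : ∀ i, S.idx i, if x = (fun i => Sum.inl (a i)) then ψ a else 0) +
      ∑ b : ∀ i, T.idx i, if x = (fun i => Sum.inr (b i)) then φ b else 0

/-- The vector `ψ^{⊗ n}`. -/
def powVec {S : Sys k} (ψ : S.H) (n : ℕ) : (S.pow n).H :=
  WithLp.toLp 2 fun x => ∏ t : Fin n, ψ (fun i => x i t)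

/-- The unit tensor `∑_{a < r} |a⟩ ⊗ ⋯ ⊗ |a⟩` of rank `r`. -/
def unitVec (k r : ℕ) : (Sys.diag k r).H :=
  WithLp.toLp 2 fun x : Fin k → Fin r => if ∃ a : Fin r, ∀ i, x i = a then 1 else 0

/-- The vector `(A₁ ⊗ ⋯ ⊗ A_k) ψ` for local operators `Aᵢ`. -/
def localApply {S T : Sys k} (A : ∀ i, Matrix (T.idx i) (S.idx i) ℂ) (ψ : S.H) : T.H :=
  WithLp.toLp 2 fun y => ∑ x : ∀ i, S.idx i, (∏ i, A i (y i) (x i)) * ψ x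

/-- The vector `(I ⊗ ⋯ ⊗ P ⊗ ⋯ ⊗ I) ψ` with `P` acting at party `j`. -/
def siteApply {S : Sys k} (j : Fin k) (P : Matrix (S.idx j) (S.idx j) ℂ) (ψ : S.H) : S.H :=
  localApply (T := S)
    (Function.update (fun i => (1 : Matrix (S.idx i) (S.idx i) ℂ)) j P) ψ

/-- A finite-round LOCC protocol from the system `S` to the target system `T`.  It either stops
(declaring success, which is possible only if the current system is `T`, or failure), or performs a
round: party `j` measures with Kraus operators `A ω j`, announces the outcome `ω`, the other parties
apply local isometries `A ω i` depending on `ω`, and the protocol continues as `next ω`. General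
local channels are obtained when later rounds ignore the outcome. -/
inductive Protocol (T : Sys k) : Sys k → Type 1
  | success : Protocol T T
  | failure (S : Sys k) : Protocol T S
  | round (S : Sys k) (j : Fin k) (N : ℕ) (S' : Fin N → Sys k)
      (A : ∀ (ω : Fin N) (i : Fin k), Matrix ((S' ω).idx i) (S.idx i) ℂ)
      (isometry : ∀ ω i, i ≠ j → (A ω i)ᴴ * A ω i = 1)
      (complete : ∑ ω, (A ω j)ᴴ * A ω j = 1)
      (next : ∀ ω, Protocol T (S' ω)) : Protocol T S

/-- The operator `|ψ⟩⟨ψ|`. -/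
def ketbra {S : Sys k} (ψ : S.H) : Matrix (∀ i, S.idx i) (∀ i, S.idx i) ℂ :=
  Matrix.vecMulVec ψ.ofLp (star ψ.ofLp)

/-- The subnormalised output state on success, for the pure input `ψ`: the sum of the
unnormalised post-measurement states `|v⟩⟨v|` over all branches that end in success. The success
probability is its trace. -/
def Protocol.output {T : Sys k} :
    {S : Sys k} → Protocol T S → S.H → Matrix (∀ i, T.idx i) (∀ i, T.idx i) ℂ
  | _, .success, ψ => ketbra ψ
  | _, .failure _, _ => 0
  | _, .round _ _ _ _ A _ _ next, ψ => ∑ ω, (next ω).output (localApply (A ω) ψ)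

/-- Some LOCC protocol transforms `ψ` into the (normalised) state `φ` with probability `p`. -/
def Transforms {S T : Sys k} (ψ : S.H) (φ : T.H) (p : ℝ) : Prop :=
  ∃ P : Protocol T S, P.output ψ = (p : ℂ) • ketbra φ

/-- The rate `R` is achievable with strong converse exponent `r` for transforming `ψ` into `φ`. -/
def Achievable {S T : Sys k} (ψ : S.H) (φ : T.H) (R r : ℝ) : Prop :=
  0 ≤ R ∧ 0 ≤ r ∧
  ∃ (M : ℕ → ℕ) (e : ℕ → ℝ),
    (fun n : ℕ => (M n : ℝ) - R * n) =o[Filter.atTop] (fun n : ℕ => (n : ℝ)) ∧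
    e =o[Filter.atTop] (fun n : ℕ => (n : ℝ)) ∧
    ∀ n : ℕ, ∃ p : ℝ, (2 : ℝ) ^ (-r * n + e n) ≤ p ∧
      Transforms (powVec ψ n) (powVec φ (M n)) p

/-- Binary relative entropy `d(q‖p)` in bits.  The formula is the relative entropy (with
`0 log 0 = 0`) whenever the latter is finite, i.e. when `p = 0` implies `q = 0` and
`p = 1` implies `q = 1`. -/
def binRelEntropy (q p : ℝ) : ℝ :=
  q * Real.logb 2 (q / p) + (1 - q) * Real.logb 2 ((1 - q) / (1 - p))

/-- Real-valued functionals on `k`-partite unnormalised vectors. -/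
abbrev Functional (k : ℕ) := ∀ S : Sys k, S.H → ℝ

/-- Elements, with exponent `α`, of the asymptotic spectrum of LOCC transformations.  At `α = 0` the
last condition is read, as usual, as its limit `F ψ ≥ max (F (Π ψ)) (F ((I - Π) ψ))`. -/
structure IsSpectralPoint (α : ℝ) (F : Functional k) : Prop where
  order_mem : α ∈ Set.Icc (0 : ℝ) 1
  nonneg : ∀ (S : Sys k) (ψ : S.H), 0 ≤ F S ψ
  isometry_invariant : ∀ (S T : Sys k) (V : ∀ i, Matrix (T.idx i) (S.idx i) ℂ) (ψ : S.H),
    (∀ i, (V i)ᴴ * V i = 1) → F T (localApply V ψ) = F S ψ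
  scaling : ∀ (S : Sys k) (ψ : S.H) (p : ℝ), 0 < p →
    F S (((Real.sqrt p : ℝ) : ℂ) • ψ) = p ^ α * F S ψ
  unit : ∀ r : ℕ, F (Sys.diag k r) (unitVec k r) = r
  multiplicative : ∀ (S T : Sys k) (ψ : S.H) (φ : T.H),
    F (S.tensor T) (tensorVec ψ φ) = F S ψ * F T φ
  additive : ∀ (S T : Sys k) (ψ : S.H) (φ : T.H),
    F (S.sum T) (sumVec ψ φ) = F S ψ + F T φ
  projection : ∀ (S : Sys k) (ψ : S.H) (j : Fin k) (P : Matrix (S.idx j) (S.idx j) ℂ),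
    P.IsHermitian → P * P = P →
      if α = 0 then max (F S (siteApply j P ψ)) (F S (siteApply j (1 - P) ψ)) ≤ F S ψ
      else F S (siteApply j P ψ) ^ (1 / α) + F S (siteApply j (1 - P) ψ) ^ (1 / α)
        ≤ F S ψ ^ (1 / α)

/-- `E` is (on nonzero vectors) a logarithmic spectral point of order `α ∈ [0, 1)`. -/
def IsLogSpectralPoint (α : ℝ) (E : Functional k) : Prop :=
  α < 1 ∧ ∃ F : Functional k, IsSpectralPoint α F ∧
    ∀ (S : Sys k) (ψ : S.H), ψ ≠ 0 → E S ψ = Real.logb 2 (F S ψ) / (1 - α)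

/-- `E` is (on normalised vectors) a logarithmic spectral point of order one: since the
normalisation `1 / (1 - α)` excludes `α = 1`, this means a pointwise limit, along some filter (net),
of logarithmic spectral points of orders `α ∈ (0, 1)` with `α → 1`. -/
def IsLogSpectralPointOne (E : Functional k) : Prop :=
  ∃ l : Filter (ℝ × Functional k), l.NeBot ∧
    (∀ᶠ x in l, x.1 ∈ Set.Ioo (0 : ℝ) 1 ∧ IsLogSpectralPoint x.1 x.2) ∧
    Filter.Tendsto Prod.fst l (nhds 1) ∧
    ∀ (S : Sys k) (ψ : S.H), ‖ψ‖ = 1 →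
      Filter.Tendsto (fun x : ℝ × Functional k => x.2 S ψ) l (nhds (E S ψ))

end

end LOCCSpectrum

open LOCCSpectrum

/-!
A protocol that succeeds with probability `p` can be run on many independent blocks. The number of
successful blocks is binomially distributed, and surplus successes can be discarded, so the
probability of at least `q N` successes out of `N` decays with exponent `d(max p q‖p)`: this gives
the achievable pairs.

For the bounds, a Naimark dilation turns the projection axiom into `∑ F(A_ω ψ)^(1/α) ≤ F(ψ)^(1/α)`
for every local measurement. Summed along the branches of a protocol, this bounds `F(ψ)^(1/α)` from
below by `p F(φ)^(1/α)` plus the contribution of the failed branches. Measuring everything in a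
product basis is itself a protocol reaching the unit tensor of rank one, whence `‖v‖² ≤ F(v)^(1/α)`;
applied to the failed branches this supplies the missing term `1 - p`. Order one follows by
weighted AM-GM and a limit.
-/

open scoped Kronecker

namespace LOCCSpectrum

noncomputable section

variable {k : ℕ}

section LocalOperators

variable {S T U : Sys k}

lemma localApply_apply (A : ∀ i, Matrix (T.idx i) (S.idx i) ℂ) (ψ : S.H) (y : ∀ i, T.idx i) :
    localApply A ψ y = ∑ x : ∀ i, S.idx i, (∏ i, A i (y i) (x i)) * ψ x := rfl

lemma localApply_localApply (B : ∀ i, Matrix (U.idx i) (T.idx i) ℂ)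
    (A : ∀ i, Matrix (T.idx i) (S.idx i) ℂ) (ψ : S.H) :
    localApply B (localApply A ψ) = localApply (fun i => B i * A i) ψ := by
  ext z
  simp only [localApply_apply, Matrix.mul_apply, Finset.prod_univ_sum, Fintype.piFinset_univ,
    Finset.mul_sum, Finset.sum_mul, Finset.prod_mul_distrib]
  rw [Finset.sum_comm]
  simp only [mul_assoc]

lemma localApply_one (ψ : S.H) :
    localApply (fun i => (1 : Matrix (S.idx i) (S.idx i) ℂ)) ψ = ψ := by
  ext z
  simp only [localApply_apply, Matrix.one_apply, Fintype.prod_boole, ← funext_iff]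
  simp

lemma localApply_smul (A : ∀ i, Matrix (T.idx i) (S.idx i) ℂ) (z : ℂ) (ψ : S.H) :
    localApply A (z • ψ) = z • localApply A ψ := by
  ext y
  simp only [localApply_apply, PiLp.smul_apply, smul_eq_mul, Finset.mul_sum]
  exact Finset.sum_congr rfl fun x _ => by ring

lemma inner_localApply_left (A : ∀ i, Matrix (T.idx i) (S.idx i) ℂ) (ψ : S.H) (χ : T.H) :
    inner ℂ (localApply A ψ) χ = inner ℂ ψ (localApply (fun i => (A i)ᴴ) χ) := by
  simp only [PiLp.inner_apply, RCLike.inner_apply, localApply_apply, map_sum, map_mul, map_prod,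
    Finset.mul_sum, Finset.sum_mul, Matrix.conjTranspose_apply]
  rw [Finset.sum_comm]
  refine Finset.sum_congr rfl fun x _ => Finset.sum_congr rfl fun y _ => ?_
  simp only [RCLike.star_def]
  ring

lemma prod_update_apply (A : ∀ i, Matrix (T.idx i) (S.idx i) ℂ) (j : Fin k)
    (M : Matrix (T.idx j) (S.idx j) ℂ) (y : ∀ i, T.idx i) (x : ∀ i, S.idx i) :
    ∏ i, Function.update A j M i (y i) (x i) =
      M (y j) (x j) * ∏ i ∈ Finset.univ.erase j, A i (y i) (x i) := by
  rw [← Finset.mul_prod_erase _ _ (Finset.mem_univ j), Function.update_self]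
  congr 1
  exact Finset.prod_congr rfl fun i hi => by
    rw [Function.update_of_ne (Finset.ne_of_mem_erase hi)]

lemma localApply_update_sum {ι : Type*} (s : Finset ι) (j : Fin k)
    (A : ∀ i, Matrix (T.idx i) (S.idx i) ℂ) (M : ι → Matrix (T.idx j) (S.idx j) ℂ) (ψ : S.H) :
    localApply (Function.update A j (∑ ω ∈ s, M ω)) ψ =
      ∑ ω ∈ s, localApply (Function.update A j (M ω)) ψ := by
  ext y
  simp only [WithLp.ofLp_sum, Finset.sum_apply, localApply_apply, prod_update_apply,
    Matrix.sum_apply, Finset.sum_mul]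
  rw [Finset.sum_comm]

lemma localApply_update_smul_one (j : Fin k) (z : ℂ) (ψ : S.H) :
    localApply (T := S) (Function.update (fun i => (1 : Matrix (S.idx i) (S.idx i) ℂ)) j (z • 1)) ψ
      = z • ψ := by
  conv_rhs => rw [← localApply_one ψ, ← Function.update_eq_self (f := fun i => 1) j]
  ext y
  simp only [PiLp.smul_apply, smul_eq_mul, localApply_apply, prod_update_apply, Matrix.smul_apply,
    Finset.mul_sum, mul_assoc]

lemma norm_sq_localApply (A : ∀ i, Matrix (T.idx i) (S.idx i) ℂ) (ψ : S.H) :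
    ‖localApply A ψ‖ ^ 2 = (inner ℂ ψ (localApply (fun i => (A i)ᴴ * A i) ψ)).re := by
  rw [norm_sq_eq_re_inner (𝕜 := ℂ), inner_localApply_left, localApply_localApply]
  rfl

lemma norm_localApply_of_isometry {V : ∀ i, Matrix (T.idx i) (S.idx i) ℂ}
    (hV : ∀ i, (V i)ᴴ * V i = 1) (ψ : S.H) : ‖localApply V ψ‖ = ‖ψ‖ := by
  refine (pow_left_inj₀ (norm_nonneg _) (norm_nonneg _) two_ne_zero).mp ?_
  simp only [norm_sq_localApply, hV, localApply_one, norm_sq_eq_re_inner (𝕜 := ℂ) ψ]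
  rfl

end LocalOperators

section LocalMeasurements

/-- The Kraus operators of one round of a protocol, as in `Protocol.round`: party `j` measures with
the operators `A ω j`, the other parties apply isometries depending on the outcome `ω`. -/
structure IsLocalMeasurement {Ω : Type*} [Fintype Ω] {S : Sys k} {S' : Ω → Sys k} (j : Fin k)
    (A : ∀ ω i, Matrix ((S' ω).idx i) (S.idx i) ℂ) : Prop where
  isometry : ∀ ω i, i ≠ j → (A ω i)ᴴ * A ω i = 1
  complete : ∑ ω, (A ω j)ᴴ * A ω j = 1

variable {Ω : Type*} [Fintype Ω] {S : Sys k} {S' : Ω → Sys k} {j : Fin k}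
  {A : ∀ ω i, Matrix ((S' ω).idx i) (S.idx i) ℂ}

lemma IsLocalMeasurement.conjTranspose_mul_self_eq_update (hA : IsLocalMeasurement j A) (ω : Ω) :
    (fun i => (A ω i)ᴴ * A ω i) = Function.update (fun _ => 1) j ((A ω j)ᴴ * A ω j) := by
  funext i
  rcases eq_or_ne i j with rfl | hi
  · rw [Function.update_self]
  · rw [Function.update_of_ne hi, hA.isometry ω i hi]

lemma IsLocalMeasurement.sum_norm_sq (hA : IsLocalMeasurement j A) (ψ : S.H) :
    ∑ ω, ‖localApply (A ω) ψ‖ ^ 2 = ‖ψ‖ ^ 2 := by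
  simp only [norm_sq_localApply, hA.conjTranspose_mul_self_eq_update]
  rw [← Complex.re_sum, ← inner_sum, ← localApply_update_sum, hA.complete,
    Function.update_eq_self, localApply_one, norm_sq_eq_re_inner (𝕜 := ℂ) ψ]
  rfl

end LocalMeasurements

section TensorProducts

variable {S S' T T' : Sys k}

lemma tensorVec_apply (ψ : S.H) (φ : T.H) (x : ∀ i, S.idx i × T.idx i) :
    tensorVec ψ φ x = ψ (fun i => (x i).1) * φ (fun i => (x i).2) := rfl

lemma powVec_apply (ψ : S.H) (n : ℕ) (x : ∀ i, Fin n → S.idx i) :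
    powVec ψ n x = ∏ t : Fin n, ψ (fun i => x i t) := rfl

lemma localApply_kronecker (A : ∀ i, Matrix (S'.idx i) (S.idx i) ℂ)
    (B : ∀ i, Matrix (T'.idx i) (T.idx i) ℂ) (ψ : S.H) (φ : T.H) :
    localApply (S := S.tensor T) (T := S'.tensor T') (fun i => A i ⊗ₖ B i) (tensorVec ψ φ) =
      tensorVec (localApply A ψ) (localApply B φ) := by
  ext y
  simp only [localApply_apply, tensorVec_apply, Matrix.kroneckerMap_apply, Finset.prod_mul_distrib]
  rw [Finset.sum_mul_sum, ← Finset.sum_product', Finset.univ_product_univ,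
    ← (Equiv.arrowProdEquivProdArrow (Fin k) S.idx T.idx).sum_comp]
  exact Finset.sum_congr rfl fun x _ => mul_mul_mul_comm _ _ _ _

lemma norm_tensorVec (ψ : S.H) (φ : T.H) : ‖tensorVec ψ φ‖ = ‖ψ‖ * ‖φ‖ := by
  refine (pow_left_inj₀ (norm_nonneg _) (by positivity) two_ne_zero).mp ?_
  rw [mul_pow, EuclideanSpace.norm_sq_eq, EuclideanSpace.norm_sq_eq, EuclideanSpace.norm_sq_eq,
    Finset.sum_mul_sum, ← Finset.sum_product', Finset.univ_product_univ,
    ← (Equiv.arrowProdEquivProdArrow (Fin k) S.idx T.idx).sum_comp]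
  exact Finset.sum_congr rfl fun x _ => by rw [tensorVec_apply, norm_mul, mul_pow]; rfl

lemma smul_tensorVec (z : ℂ) (ψ : S.H) (φ : T.H) :
    tensorVec (z • ψ) φ = z • tensorVec ψ φ := by
  ext y
  simp only [tensorVec_apply, PiLp.smul_apply, smul_eq_mul, mul_assoc]

lemma kronecker_one_conjTranspose_mul_self {l m n : Type*} [Fintype l] [Fintype n] [DecidableEq n]
    (A : Matrix l m ℂ) :
    (A ⊗ₖ (1 : Matrix n n ℂ))ᴴ * (A ⊗ₖ (1 : Matrix n n ℂ)) = (Aᴴ * A) ⊗ₖ (1 : Matrix n n ℂ) := by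
  rw [Matrix.conjTranspose_kronecker, Matrix.conjTranspose_one, ← Matrix.mul_kronecker_mul, one_mul]

lemma IsLocalMeasurement.tensor {Ω : Type*} [Fintype Ω] {S' : Ω → Sys k} {j : Fin k}
    {A : ∀ ω i, Matrix ((S' ω).idx i) (S.idx i) ℂ} (hA : IsLocalMeasurement j A) (R : Sys k) :
    IsLocalMeasurement (S := S.tensor R) (S' := fun ω => (S' ω).tensor R) j
      fun ω i => A ω i ⊗ₖ (1 : Matrix (R.idx i) (R.idx i) ℂ) where
  isometry ω i hi := by
    rw [kronecker_one_conjTranspose_mul_self, hA.isometry ω i hi, Matrix.one_kronecker_one]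
  complete := by
    have sum_kronecker : ∑ ω, ((A ω j)ᴴ * A ω j) ⊗ₖ (1 : Matrix (R.idx j) (R.idx j) ℂ) =
        (∑ ω, (A ω j)ᴴ * A ω j) ⊗ₖ 1 := by
      ext
      simp only [Matrix.sum_apply, Matrix.kroneckerMap_apply, Finset.sum_mul]
    simp only [kronecker_one_conjTranspose_mul_self]
    rw [sum_kronecker, hA.complete, Matrix.one_kronecker_one]

end TensorProducts

section Relabelling

/-- `ψ` becomes `φ` when every party renames its basis vectors. -/
def Relabels {S T : Sys k} (ψ : S.H) (φ : T.H) : Prop :=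
  ∃ e : ∀ i, S.idx i ≃ T.idx i, ∀ x : ∀ i, S.idx i, φ (fun i => e i (x i)) = ψ x

variable {S T : Sys k} {ψ : S.H} {φ : T.H}

lemma Relabels.symm (h : Relabels ψ φ) : Relabels φ ψ := by
  obtain ⟨e, he⟩ := h
  exact ⟨fun i => (e i).symm, fun x => by rw [← he]; simp only [Equiv.apply_symm_apply]⟩

lemma exists_isometry_of_equiv (e : ∀ i, S.idx i ≃ T.idx i) :
    ∃ V : ∀ i, Matrix (T.idx i) (S.idx i) ℂ, (∀ i, (V i)ᴴ * V i = 1) ∧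
      ∀ (ψ : S.H) (φ : T.H), (∀ x : ∀ i, S.idx i, φ (fun i => e i (x i)) = ψ x) →
        localApply V ψ = φ := by
  refine ⟨fun i => (1 : Matrix (T.idx i) (T.idx i) ℂ).submatrix id (e i), fun i => ?_,
    fun ψ φ he => ?_⟩
  · rw [Matrix.conjTranspose_submatrix, Matrix.conjTranspose_one,
      ← Matrix.submatrix_mul _ _ _ _ _ Function.bijective_id, one_mul, Matrix.submatrix_one_equiv]
  · ext y
    rw [← localApply_one φ, localApply_apply, localApply_apply, ← (Equiv.piCongrRight e).sum_comp]
    exact Finset.sum_congr rfl fun x _ => congrArg _ (he x).symm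

lemma Relabels.exists_isometry (h : Relabels ψ φ) :
    ∃ V : ∀ i, Matrix (T.idx i) (S.idx i) ℂ, (∀ i, (V i)ᴴ * V i = 1) ∧ localApply V ψ = φ := by
  obtain ⟨e, he⟩ := h
  obtain ⟨V, hV, apply_eq⟩ := exists_isometry_of_equiv e
  exact ⟨V, hV, apply_eq ψ φ he⟩

lemma Relabels.norm_eq (h : Relabels ψ φ) : ‖φ‖ = ‖ψ‖ := by
  obtain ⟨V, hV, rfl⟩ := h.exists_isometry
  exact norm_localApply_of_isometry hV ψ

lemma relabels_tensorVec_comm (ψ : S.H) (φ : T.H) : Relabels (tensorVec ψ φ) (tensorVec φ ψ) :=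
  ⟨fun _ => Equiv.prodComm _ _, fun _ => mul_comm _ _⟩

lemma relabels_tensorVec_unitVec (ψ : S.H) : Relabels (tensorVec ψ (unitVec k 1)) ψ :=
  ⟨fun _ => Equiv.prodUnique _ _, fun x => by
    have : ∃ a : Fin 1, ∀ i, (x i).2 = a := ⟨0, fun i => Subsingleton.elim _ _⟩
    exact ((mul_one _).symm.trans (congrArg _ (if_pos this).symm))⟩

lemma relabels_powVec_zero (ψ : S.H) : Relabels (powVec ψ 0) (unitVec k 1) :=
  ⟨fun i => Equiv.ofUnique (Fin 0 → S.idx i) (Fin 1), fun x => by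
    simp [powVec_apply, unitVec]⟩

lemma relabels_powVec_succ (ψ : S.H) (n : ℕ) :
    Relabels (powVec ψ (n + 1)) (tensorVec ψ (powVec ψ n)) :=
  ⟨fun i => (Fin.consEquiv fun _ => S.idx i).symm, fun x => by
    rw [powVec_apply, Fin.prod_univ_succ]; rfl⟩

lemma relabels_powVec_powVec (ψ : S.H) (n N : ℕ) :
    Relabels (powVec (powVec ψ n) N) (powVec ψ (N * n)) :=
  ⟨fun i => (Equiv.curry (Fin N) (Fin n) (S.idx i)).symm.trans
      (finProdFinEquiv.arrowCongr (Equiv.refl _)), fun x => by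
    simp [-finProdFinEquiv_symm_apply, powVec_apply, ← finProdFinEquiv.prod_comp,
      Fintype.prod_prod_type]⟩

lemma norm_powVec (ψ : S.H) (n : ℕ) : ‖powVec ψ n‖ = ‖ψ‖ ^ n := by
  induction n with
  | zero =>
    rw [pow_zero, EuclideanSpace.norm_eq]
    simp [powVec_apply]
  | succ n ih => rw [← (relabels_powVec_succ ψ n).norm_eq, norm_tensorVec, ih, pow_succ']

lemma norm_unitVec_one : ‖unitVec k 1‖ = 1 := by
  rw [(relabels_powVec_zero (unitVec k 1)).norm_eq, norm_powVec, pow_zero]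

end Relabelling

section Protocols

lemma ketbra_smul {S : Sys k} (z : ℂ) (ψ : S.H) :
    ketbra (z • ψ) = ((‖z‖ ^ 2 : ℝ) : ℂ) • ketbra ψ := by
  ext x y
  simp only [ketbra, Matrix.vecMulVec_apply, WithLp.ofLp_smul, Pi.smul_apply, Pi.star_apply,
    smul_eq_mul, star_mul', Matrix.smul_apply, Complex.ofReal_pow, ← Complex.mul_conj',
    starRingEnd_apply]
  ring

lemma trace_ketbra {S : Sys k} (ψ : S.H) : (ketbra ψ).trace = ((‖ψ‖ ^ 2 : ℝ) : ℂ) := by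
  rw [ketbra, Matrix.trace_vecMulVec, ← EuclideanSpace.inner_eq_star_dotProduct,
    inner_self_eq_norm_sq_to_K]
  push_cast
  rfl

lemma dotProduct_ketbra_mulVec {S : Sys k} (ψ w : S.H) :
    star w.ofLp ⬝ᵥ (ketbra ψ *ᵥ w.ofLp) = ((‖(inner ℂ w ψ : ℂ)‖ ^ 2 : ℝ) : ℂ) := by
  rw [ketbra, Matrix.vecMulVec_mulVec, dotProduct_smul, dotProduct_comm _ ψ.ofLp,
    dotProduct_comm _ w.ofLp, ← EuclideanSpace.inner_eq_star_dotProduct,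
    ← EuclideanSpace.inner_eq_star_dotProduct, op_smul_eq_mul, ← inner_conj_symm ψ w,
    Complex.mul_conj', Complex.ofReal_pow]

variable {S T R U : Sys k}

namespace Protocol

lemma output_smul (P : Protocol T S) (z : ℂ) (ψ : S.H) :
    P.output (z • ψ) = ((‖z‖ ^ 2 : ℝ) : ℂ) • P.output ψ := by
  induction P with
  | success => exact ketbra_smul z ψ
  | failure S => exact (smul_zero _).symm
  | round S j N S' A isometry complete next ih =>
    simp only [output, localApply_smul, ih, Finset.smul_sum]

/-- The probability that the protocol ends in success on the input `ψ`; for an unnormalised input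
it is scaled by `‖ψ‖ ^ 2`. -/
def prob (P : Protocol T S) (ψ : S.H) : ℝ := (P.output ψ).trace.re

lemma prob_success (ψ : T.H) : (success : Protocol T T).prob ψ = ‖ψ‖ ^ 2 := by
  simp only [prob, output, trace_ketbra, Complex.ofReal_re]

lemma prob_failure (ψ : S.H) : (failure S : Protocol T S).prob ψ = 0 := by
  simp only [prob, output, Matrix.trace_zero, Complex.zero_re]

lemma prob_round {j : Fin k} {N : ℕ} {S' : Fin N → Sys k}
    {A : ∀ (ω : Fin N) (i : Fin k), Matrix ((S' ω).idx i) (S.idx i) ℂ}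
    (hA : IsLocalMeasurement j A) (next : ∀ ω, Protocol T (S' ω)) (ψ : S.H) :
    (round S j N S' A hA.isometry hA.complete next).prob ψ =
      ∑ ω, (next ω).prob (localApply (A ω) ψ) := by
  simp only [prob, output, Matrix.trace_sum, Complex.re_sum]

lemma prob_eq_of_output_eq {P : Protocol T S} {ψ : S.H} {φ : T.H} (hφ : ‖φ‖ = 1) {p : ℝ}
    (h : P.output ψ = (p : ℂ) • ketbra φ) : P.prob ψ = p := by
  simp [prob, h, trace_ketbra, hφ]

/-- Every successful branch on the input `ψ` ends in a multiple of `φ`. -/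
def Aligned (φ : T.H) : {S : Sys k} → Protocol T S → S.H → Prop
  | _, .success, ψ => ∃ z : ℂ, ψ = z • φ
  | _, .failure _, _ => True
  | _, .round _ _ _ _ A _ _ next, ψ => ∀ ω, Aligned φ (next ω) (localApply (A ω) ψ)

open scoped ComplexOrder in
lemma output_posSemidef (P : Protocol T S) (ψ : S.H) : (P.output ψ).PosSemidef := by
  induction P with
  | success => exact Matrix.posSemidef_vecMulVec_self_star _
  | failure S => exact Matrix.PosSemidef.zero
  | round _ _ _ _ _ _ _ _ ih => exact Matrix.posSemidef_sum _ fun ω _ => ih ω _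

open scoped ComplexOrder in
lemma aligned_of_forall_dotProduct_eq_zero {φ : T.H} (P : Protocol T S) (ψ : S.H)
    (h : ∀ w : T.H, inner ℂ w φ = 0 → star w.ofLp ⬝ᵥ (P.output ψ *ᵥ w.ofLp) = 0) :
    P.Aligned φ ψ := by
  induction P with
  | success =>
    have mem : ψ ∈ (ℂ ∙ φ)ᗮᗮ := fun w hw => by
      have := h w (Submodule.mem_orthogonal_singleton_iff_inner_left.mp hw)
      simpa [output, dotProduct_ketbra_mulVec] using this
    rw [Submodule.orthogonal_orthogonal, Submodule.mem_span_singleton] at mem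
    exact mem.imp fun _ => Eq.symm
  | failure S => trivial
  | round S j N S' A isometry complete next ih =>
    intro ω
    refine ih ω _ fun w hw => ?_
    have sum_eq_zero := h w hw
    simp only [output, Matrix.sum_mulVec, dotProduct_sum] at sum_eq_zero
    exact (Finset.sum_eq_zero_iff_of_nonneg fun ω _ =>
      (output_posSemidef (next ω) _).dotProduct_mulVec_nonneg w.ofLp).mp sum_eq_zero ω
        (Finset.mem_univ ω)

lemma aligned_of_output_eq {φ : T.H} {P : Protocol T S} {ψ : S.H} {c : ℂ}
    (h : P.output ψ = c • ketbra φ) : P.Aligned φ ψ :=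
  aligned_of_forall_dotProduct_eq_zero P ψ fun w hw => by
    rw [h, Matrix.smul_mulVec, dotProduct_smul, dotProduct_ketbra_mulVec, hw]
    simp

lemma exists_measurement {Ω : Type*} [Fintype Ω] {S' : Ω → Sys k} {j : Fin k}
    {A : ∀ ω i, Matrix ((S' ω).idx i) (S.idx i) ℂ} (hA : IsLocalMeasurement j A)
    (next : ∀ ω, Protocol T (S' ω)) :
    ∃ P : Protocol T S, ∀ ψ, P.output ψ = ∑ ω, (next ω).output (localApply (A ω) ψ) := by
  let e := (Fintype.equivFin Ω).symm
  refine ⟨.round S j (Fintype.card Ω) (fun ω => S' (e ω)) (fun ω => A (e ω))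
    (fun ω => hA.isometry (e ω)) ?_ (fun ω => next (e ω)), fun ψ => ?_⟩
  · rw [e.sum_comp fun ω => (A ω j)ᴴ * A ω j, hA.complete]
  · exact e.sum_comp fun ω => (next ω).output (localApply (A ω) ψ)

lemma exists_localIsometry [NeZero k] {V : ∀ i, Matrix (T.idx i) (S.idx i) ℂ}
    (hV : ∀ i, (V i)ᴴ * V i = 1) (Q : Protocol U T) :
    ∃ P : Protocol U S, ∀ ψ, P.output ψ = Q.output (localApply V ψ) := by
  have hA : IsLocalMeasurement (0 : Fin k) (Ω := Unit) (S' := fun _ => T) fun _ => V :=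
    ⟨fun _ i _ => hV i, by simp [hV]⟩
  obtain ⟨P, hP⟩ := exists_measurement hA fun _ => Q
  exact ⟨P, fun ψ => by rw [hP, Fintype.sum_unique]⟩

lemma exists_measurement_tensor {Ω : Type*} [Fintype Ω] {S' : Ω → Sys k} {j : Fin k}
    {A : ∀ ω i, Matrix ((S' ω).idx i) (S.idx i) ℂ} (hA : IsLocalMeasurement j A)
    (next : ∀ ω, Protocol U ((S' ω).tensor R)) :
    ∃ P : Protocol U (S.tensor R), ∀ (ψ : S.H) (ρ : R.H),
      P.output (tensorVec ψ ρ) = ∑ ω, (next ω).output (tensorVec (localApply (A ω) ψ) ρ) := by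
  obtain ⟨P, hP⟩ := exists_measurement (hA.tensor R) next
  refine ⟨P, fun ψ ρ => (hP _).trans (Finset.sum_congr rfl fun ω _ => congrArg _ ?_)⟩
  have := localApply_kronecker (A ω) (fun i => (1 : Matrix (R.idx i) (R.idx i) ℂ)) ψ ρ
  rwa [localApply_one] at this

end Protocol

end Protocols

section Discarding

/-- The subsystem of `S` in which party `i` keeps only the basis vectors in `a i`. -/
abbrev Sys.restrict (S : Sys k) (a : ∀ i, Finset (S.idx i)) : Sys k where
  idx i := a i

variable {S T R U : Sys k}

lemma conjTranspose_submatrix_val_mul_self {n : Type*} [DecidableEq n] (s : Finset n) :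
    ((1 : Matrix n n ℂ).submatrix (Subtype.val : s → n) id)ᴴ *
      (1 : Matrix n n ℂ).submatrix (Subtype.val : s → n) id =
        Matrix.diagonal fun x => if x ∈ s then 1 else 0 := by
  ext x y
  rw [Matrix.mul_apply, Finset.univ_eq_attach, Matrix.diagonal_apply]
  simp only [Matrix.conjTranspose_apply, Matrix.submatrix_apply, id, Matrix.one_apply,
    apply_ite star, star_one, star_zero, ite_mul, one_mul, zero_mul]
  rw [Finset.sum_attach s fun z => if z = x then if z = y then (1 : ℂ) else 0 else 0,
    Finset.sum_ite_eq']
  split_ifs <;> rfl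

lemma isLocalMeasurement_basis (S : Sys k) (j : Fin k) :
    IsLocalMeasurement (Ω := S.idx j)
      (S' := fun ω => S.restrict (Function.update (fun _ => Finset.univ) j {ω})) j
      fun _ i => (1 : Matrix (S.idx i) (S.idx i) ℂ).submatrix Subtype.val id where
  isometry ω i hi := by
    rw [conjTranspose_submatrix_val_mul_self, Function.update_of_ne hi]
    simp
  complete := by
    simp only [conjTranspose_submatrix_val_mul_self, Function.update_self, Finset.mem_singleton]
    ext x y
    simp [Matrix.sum_apply, Matrix.diagonal_apply, Matrix.one_apply]

namespace Protocol

lemma exists_discard_of_card_eq_one [NeZero k] (Q : Protocol U R)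
    (hS : ∀ i, Fintype.card (S.idx i) = 1) :
    ∃ D : Protocol U (S.tensor R), ∀ (v : S.H) (ρ : R.H),
      D.output (tensorVec v ρ) = ((‖v‖ ^ 2 : ℝ) : ℂ) • Q.output ρ := by
  have (i : Fin k) : Unique (S.idx i) :=
    (Fintype.card_eq_one_iff_nonempty_unique.mp (hS i)).some
  obtain ⟨V, hV, apply_eq⟩ := exists_isometry_of_equiv (S := S.tensor R) (T := R)
    fun i => Equiv.uniqueProd (R.idx i) (S.idx i)
  obtain ⟨D, hD⟩ := exists_localIsometry hV Q
  refine ⟨D, fun v ρ => ?_⟩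
  have tensorVec_eq : localApply V (tensorVec v ρ) = v default • ρ :=
    apply_eq _ _ fun x => by
      rw [tensorVec_apply, Subsingleton.elim (fun i => (x i).1) default]
      rfl
  rw [hD, tensorVec_eq, output_smul, EuclideanSpace.norm_sq_eq, Fintype.sum_unique]

/-- Party by party, the first tensor factor is measured in the standard basis. -/
lemma exists_discard [NeZero k] (Q : Protocol U R) (S : Sys k) :
    ∃ D : Protocol U (S.tensor R), ∀ (v : S.H) (ρ : R.H),
      D.output (tensorVec v ρ) = ((‖v‖ ^ 2 : ℝ) : ℂ) • Q.output ρ := by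
  suffices ∀ (s : Finset (Fin k)) (S : Sys k), (∀ i ∉ s, Fintype.card (S.idx i) = 1) →
      ∃ D : Protocol U (S.tensor R), ∀ (v : S.H) (ρ : R.H),
        D.output (tensorVec v ρ) = ((‖v‖ ^ 2 : ℝ) : ℂ) • Q.output ρ from
    this Finset.univ S fun i hi => absurd (Finset.mem_univ i) hi
  intro s
  induction s using Finset.induction_on with
  | empty =>
    exact fun S hS => exists_discard_of_card_eq_one Q fun i => hS i (Finset.notMem_empty i)
  | insert j s _ ih =>
    intro S hS
    have card_restrict (ω : S.idx j) (i : Fin k) (hi : i ∉ s) :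
        Fintype.card ((S.restrict (Function.update (fun _ => Finset.univ) j {ω})).idx i) = 1 := by
      rw [Fintype.card_coe]
      rcases eq_or_ne i j with rfl | hij
      · rw [Function.update_self, Finset.card_singleton]
      · rw [Function.update_of_ne hij, Finset.card_univ, hS i (by simp [hij, hi])]
    choose D hD using fun ω => ih _ (card_restrict ω)
    obtain ⟨P, hP⟩ := exists_measurement_tensor (isLocalMeasurement_basis S j) D
    refine ⟨P, fun v ρ => ?_⟩
    simp only [hP, hD]
    rw [← Finset.sum_smul, ← Complex.ofReal_sum, (isLocalMeasurement_basis S j).sum_norm_sq]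

end Protocol

end Discarding

section Transformations

variable {S T R U : Sys k} {ψ : S.H} {φ : T.H} {ρ : R.H} {χ : U.H} {p a b : ℝ}

/-- Run `P` on the first tensor factor; after a success go on with `Qs`, otherwise discard the first
factor and go on with `Qf`. -/
lemma Protocol.exists_bind [NeZero k] (hφ : ‖φ‖ = 1) (Qs : Protocol U (T.tensor R))
    (Qf : Protocol U R) (P : Protocol T S) :
    ∃ B : Protocol U (S.tensor R), ∀ (ψ : S.H) (ρ : R.H), P.Aligned φ ψ →
      B.output (tensorVec ψ ρ) = (P.prob ψ : ℂ) • Qs.output (tensorVec φ ρ) +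
        ((‖ψ‖ ^ 2 - P.prob ψ : ℝ) : ℂ) • Qf.output ρ := by
  induction P with
  | success =>
    refine ⟨Qs, ?_⟩
    rintro ψ ρ ⟨z, rfl⟩
    rw [prob_success, smul_tensorVec, output_smul, norm_smul, hφ, mul_one, sub_self,
      Complex.ofReal_zero, zero_smul, add_zero]
  | failure S =>
    obtain ⟨D, hD⟩ := exists_discard Qf S
    refine ⟨D, fun ψ ρ _ => ?_⟩
    rw [hD, prob_failure, sub_zero, Complex.ofReal_zero, zero_smul, zero_add]
  | round S j N S' A isometry complete next ih =>
    have hA : IsLocalMeasurement j A := ⟨isometry, complete⟩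
    choose B hB using ih
    obtain ⟨P, hP⟩ := exists_measurement_tensor hA B
    refine ⟨P, fun ψ ρ h => ?_⟩
    rw [hP, prob_round hA, ← hA.sum_norm_sq ψ, Finset.sum_congr rfl fun ω _ => hB ω _ ρ (h ω),
      Finset.sum_add_distrib, ← Finset.sum_smul, ← Finset.sum_smul, ← Finset.sum_sub_distrib,
      Complex.ofReal_sum, Complex.ofReal_sum]

namespace Transforms

lemma bind [NeZero k] (hφ : ‖φ‖ = 1) (h : Transforms ψ φ p)
    (hs : Transforms (tensorVec φ ρ) χ a) (hf : Transforms ρ χ b) :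
    Transforms (tensorVec ψ ρ) χ (p * a + (‖ψ‖ ^ 2 - p) * b) := by
  obtain ⟨P, hP⟩ := h
  obtain ⟨Qs, hs⟩ := hs
  obtain ⟨Qf, hf⟩ := hf
  obtain ⟨B, hB⟩ := Protocol.exists_bind hφ Qs Qf P
  refine ⟨B, ?_⟩
  rw [hB ψ ρ (Protocol.aligned_of_output_eq hP), Protocol.prob_eq_of_output_eq hφ hP, hs, hf,
    smul_smul, smul_smul, ← add_smul]
  push_cast
  rfl

lemma refl (ψ : S.H) : Transforms ψ ψ 1 :=
  ⟨.success, by rw [Protocol.output, Complex.ofReal_one, one_smul]⟩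

lemma zero (ψ : S.H) (φ : T.H) : Transforms ψ φ 0 :=
  ⟨.failure S, by rw [Protocol.output, Complex.ofReal_zero, zero_smul]⟩

lemma discard_left [NeZero k] (ψ : S.H) (h : Transforms ρ χ p) :
    Transforms (tensorVec ψ ρ) χ (‖ψ‖ ^ 2 * p) := by
  obtain ⟨Q, hQ⟩ := h
  obtain ⟨D, hD⟩ := Protocol.exists_discard Q S
  exact ⟨D, by rw [hD, hQ, smul_smul, Complex.ofReal_mul]⟩

lemma relabel_left [NeZero k] (h : Transforms φ χ p) (hψ : Relabels ψ φ) : Transforms ψ χ p := by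
  obtain ⟨V, hV, rfl⟩ := hψ.exists_isometry
  obtain ⟨Q, hQ⟩ := h
  obtain ⟨P, hP⟩ := Protocol.exists_localIsometry hV Q
  exact ⟨P, by rw [hP, hQ]⟩

lemma to_unitVec_one [NeZero k] (ψ : S.H) : Transforms ψ (unitVec k 1) (‖ψ‖ ^ 2) := by
  simpa using ((refl (unitVec k 1)).discard_left ψ).relabel_left (relabels_tensorVec_unitVec ψ).symm

lemma trans [NeZero k] (hφ : ‖φ‖ = 1) (h : Transforms ψ φ p) (h' : Transforms φ χ a) :
    Transforms ψ χ (p * a) := by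
  have := bind hφ h (h'.relabel_left (relabels_tensorVec_unitVec φ)) (zero (unitVec k 1) χ)
  rw [mul_zero, add_zero] at this
  exact this.relabel_left (relabels_tensorVec_unitVec ψ).symm

lemma relabel_right [NeZero k] (h : Transforms ψ φ p) (hφ : ‖φ‖ = 1) (hχ : Relabels φ χ) :
    Transforms ψ χ p := by
  simpa using h.trans hφ ((refl χ).relabel_left hχ)

lemma tensor_left [NeZero k] (hφ : ‖φ‖ = 1) (hρ : ‖ρ‖ = 1) (h : Transforms ψ φ p) :
    Transforms (tensorVec ρ ψ) (tensorVec ρ φ) p := by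
  have := bind hφ h (refl (tensorVec φ ρ)) (zero ρ _)
  rw [mul_zero, add_zero, mul_one] at this
  exact (this.relabel_left (relabels_tensorVec_comm ρ ψ)).relabel_right
    (by rw [norm_tensorVec, hφ, hρ, mul_one]) (relabels_tensorVec_comm φ ρ)

lemma powVec_of_le [NeZero k] (hψ : ‖ψ‖ = 1) {m n : ℕ} (hmn : m ≤ n) :
    Transforms (powVec ψ n) (powVec ψ m) 1 := by
  induction n, hmn using Nat.le_induction with
  | base => exact refl _
  | succ n _ ih => simpa [hψ] using (ih.discard_left ψ).relabel_left (relabels_powVec_succ ψ n)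

/-- Pascal's rule: the first copy either succeeds and `s` of the remaining ones do, or it fails and
`s + 1` of the remaining ones succeed. -/
lemma powVec [NeZero k] (hψ : ‖ψ‖ = 1) (hφ : ‖φ‖ = 1) (h : Transforms ψ φ p) (N s : ℕ) :
    Transforms (powVec ψ N) (powVec φ s) (N.choose s * p ^ s * (1 - p) ^ (N - s)) := by
  induction N generalizing s with
  | zero =>
    cases s with
    | zero =>
      simpa [norm_powVec, hψ] using ((to_unitVec_one (LOCCSpectrum.powVec ψ 0)).relabel_right
        norm_unitVec_one (relabels_powVec_zero φ).symm)
    | succ s => simpa using zero _ _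
  | succ N ih =>
    cases s with
    | zero =>
      have := (bind hφ h (zero _ _) (ih 0)).relabel_left (relabels_powVec_succ ψ N)
      convert this using 1
      simp [hψ, pow_succ']
    | succ s =>
      have norm_powVec_succ : ‖tensorVec φ (LOCCSpectrum.powVec φ s)‖ = 1 := by
        rw [norm_tensorVec, norm_powVec, hφ, one_pow, one_mul]
      have success := ((ih s).tensor_left (by rw [norm_powVec, hφ, one_pow]) hφ).relabel_right
        norm_powVec_succ (relabels_powVec_succ φ s).symm
      have := (bind hφ h success (ih (s + 1))).relabel_left (relabels_powVec_succ ψ N)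
      convert this using 1
      rw [Nat.choose_succ_succ, hψ]
      rcases Nat.lt_or_ge N (s + 1) with hN | hN
      · rw [Nat.choose_eq_zero_of_lt hN, Nat.add_sub_add_right]
        push_cast
        ring
      · obtain ⟨d, rfl⟩ := Nat.exists_eq_add_of_le hN
        rw [show s + 1 + d + 1 - (s + 1) = d + 1 by omega, show s + 1 + d - s = d + 1 by omega,
          Nat.add_sub_cancel_left]
        push_cast
        ring

end Transforms

end Transformations

section BinomialDistribution

lemma factorial_mul_pow_le_factorial_mul_pow_self (s j : ℕ) :
    s.factorial * s ^ j ≤ j.factorial * s ^ s := by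
  rcases le_total s j with h | h
  · calc s.factorial * s ^ j = s.factorial * s ^ (j - s) * s ^ s := by
          rw [mul_assoc, ← pow_add, Nat.sub_add_cancel h]
      _ ≤ j.factorial * s ^ s := Nat.mul_le_mul_right _ (Nat.factorial_mul_pow_sub_le_factorial h)
  · have factorial_eq := Nat.factorial_mul_descFactorial (Nat.sub_le s j)
    rw [Nat.sub_sub_self h] at factorial_eq
    calc s.factorial * s ^ j = j.factorial * s.descFactorial (s - j) * s ^ j := by rw [factorial_eq]
      _ ≤ j.factorial * s ^ (s - j) * s ^ j := by gcongr; exact Nat.descFactorial_le_pow _ _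
      _ = j.factorial * s ^ s := by rw [mul_assoc, ← pow_add, Nat.sub_add_cancel h]

/-- The binomial distribution with mean `s` has its mode at `s`. -/
lemma choose_mul_pow_le_choose_mul_pow_self {N s j : ℕ} (hs : s ≤ N) (hj : j ≤ N) :
    N.choose j * (s ^ j * (N - s) ^ (N - j)) ≤ N.choose s * (s ^ s * (N - s) ^ (N - s)) := by
  have choose_s := Nat.choose_mul_factorial_mul_factorial hs
  have choose_j := Nat.choose_mul_factorial_mul_factorial hj
  refine Nat.le_of_mul_le_mul_right (c := s.factorial * (N - s).factorial *
    (j.factorial * (N - j).factorial)) ?_ (by positivity)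
  calc N.choose j * (s ^ j * (N - s) ^ (N - j)) *
        (s.factorial * (N - s).factorial * (j.factorial * (N - j).factorial))
      = (N.choose j * j.factorial * (N - j).factorial) *
          (s.factorial * s ^ j * ((N - s).factorial * (N - s) ^ (N - j))) := by ring
    _ ≤ (N.choose j * j.factorial * (N - j).factorial) *
          (j.factorial * s ^ s * ((N - j).factorial * (N - s) ^ (N - s))) :=
        Nat.mul_le_mul_left _ (Nat.mul_le_mul (factorial_mul_pow_le_factorial_mul_pow_self s j)
          (factorial_mul_pow_le_factorial_mul_pow_self (N - s) (N - j)))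
    _ = N.choose s * (s ^ s * (N - s) ^ (N - s)) *
        (s.factorial * (N - s).factorial * (j.factorial * (N - j).factorial)) := by
      rw [choose_j, ← choose_s]; ring

lemma pow_self_le_choose_mul_pow_self {N s : ℕ} (hs : s ≤ N) :
    N ^ N ≤ (N + 1) * (N.choose s * (s ^ s * (N - s) ^ (N - s))) := by
  calc N ^ N = (s + (N - s)) ^ N := by rw [Nat.add_sub_cancel' hs]
    _ = ∑ j ∈ Finset.range (N + 1), N.choose j * (s ^ j * (N - s) ^ (N - j)) := by
      rw [add_pow]
      exact Finset.sum_congr rfl fun j _ => mul_comm _ _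
    _ ≤ ∑ _j ∈ Finset.range (N + 1), N.choose s * (s ^ s * (N - s) ^ (N - s)) :=
      Finset.sum_le_sum fun _ hj =>
        choose_mul_pow_le_choose_mul_pow_self hs (Finset.mem_range_succ_iff.mp hj)
    _ = _ := by rw [Finset.sum_const, Finset.card_range, smul_eq_mul]

lemma one_le_choose_mul_div_pow {N s : ℕ} (hs : s ≤ N) :
    1 ≤ (N + 1 : ℝ) * (N.choose s * ((s / N : ℝ) ^ s * (1 - s / N : ℝ) ^ (N - s))) := by
  rcases Nat.eq_zero_or_pos N with rfl | hN
  · simp [Nat.le_zero.mp hs]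
  have hN' : (0 : ℝ) < N := Nat.cast_pos.mpr hN
  have pow_le : (N : ℝ) ^ N ≤ (N + 1) * (N.choose s * ((s : ℝ) ^ s * (N - s) ^ (N - s))) := by
    have := pow_self_le_choose_mul_pow_self hs
    rw [← Nat.cast_sub hs]
    exact_mod_cast this
  calc (1 : ℝ) = (N : ℝ) ^ N / (N ^ s * N ^ (N - s)) := by
        rw [← pow_add, Nat.add_sub_cancel' hs, div_self (by positivity)]
    _ ≤ (N + 1) * (N.choose s * ((s : ℝ) ^ s * (N - s) ^ (N - s))) / (N ^ s * N ^ (N - s)) := by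
        gcongr
    _ = _ := by rw [one_sub_div hN'.ne', div_pow, div_pow]; ring

end BinomialDistribution

section BinaryRelativeEntropy

open Filter Topology InformationTheory

variable {p x : ℝ}

lemma mul_logb_div_eq_klFun (hp : 0 < p) (x : ℝ) :
    x * Real.logb 2 (x / p) = (p * klFun (x / p) + (x - p)) / Real.log 2 := by
  rw [klFun, Real.logb]
  field_simp
  ring

lemma binRelEntropy_eq_klFun (hp0 : 0 < p) (hp1 : p < 1) (x : ℝ) :
    binRelEntropy x p =
      (p * klFun (x / p) + (1 - p) * klFun ((1 - x) / (1 - p))) / Real.log 2 := by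
  rw [binRelEntropy, mul_logb_div_eq_klFun hp0, mul_logb_div_eq_klFun (sub_pos.mpr hp1)]
  ring

lemma continuous_binRelEntropy (hp0 : 0 < p) (hp1 : p < 1) :
    Continuous fun x => binRelEntropy x p := by
  simp only [binRelEntropy_eq_klFun hp0 hp1]
  fun_prop

lemma binRelEntropy_nonneg (hp0 : 0 < p) (hp1 : p < 1) (hx : x ∈ Set.Icc (0 : ℝ) 1) :
    0 ≤ binRelEntropy x p := by
  rw [binRelEntropy_eq_klFun hp0 hp1]
  have := sub_nonneg.mpr hx.2
  have := sub_pos.mpr hp1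
  have := klFun_nonneg (div_nonneg hx.1 hp0.le)
  have : 0 ≤ klFun ((1 - x) / (1 - p)) := klFun_nonneg (by positivity)
  have := Real.log_pos one_lt_two
  positivity

lemma logb_div_self (b x : ℝ) : Real.logb b (x / x) = 0 := by
  rcases eq_or_ne x 0 with rfl | hx
  · rw [div_zero, Real.logb_zero]
  · rw [div_self hx, Real.logb_one]

lemma binRelEntropy_self (p : ℝ) : binRelEntropy p p = 0 := by
  simp only [binRelEntropy, logb_div_self, mul_zero, add_zero]

lemma pow_mul_two_rpow_neg_mul_logb_div (hp : 0 < p) {s : ℕ} (hx : s ≠ 0 → 0 < x) :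
    x ^ s * (2 : ℝ) ^ (-(s * Real.logb 2 (x / p))) = p ^ s := by
  rcases eq_or_ne s 0 with rfl | hs
  · simp
  have hx := hx hs
  rw [← mul_neg, mul_comm (s : ℝ), Real.rpow_mul_natCast zero_le_two, Real.rpow_neg zero_le_two,
    Real.rpow_logb two_pos one_lt_two.ne' (by positivity), inv_div, div_pow]
  field_simp

lemma two_rpow_neg_mul_binRelEntropy_le (hp0 : 0 < p) (hp1 : p < 1) {N s : ℕ} (hs : s ≤ N) :
    (2 : ℝ) ^ (-(N * binRelEntropy (s / N) p)) ≤
      (N + 1) * (N.choose s * p ^ s * (1 - p) ^ (N - s)) := by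
  rcases Nat.eq_zero_or_pos N with rfl | hN
  · simp [Nat.le_zero.mp hs]
  have hN' : (0 : ℝ) < N := Nat.cast_pos.mpr hN
  set x : ℝ := s / N with hx
  have one_sub_x : 1 - x = (N - s : ℕ) / N := by
    rw [hx, one_sub_div hN'.ne', Nat.cast_sub hs]
  have exponent : -(N * binRelEntropy x p) = -(s * Real.logb 2 (x / p)) +
      -((N - s : ℕ) * Real.logb 2 ((1 - x) / (1 - p))) := by
    have hs' : (s : ℝ) = N * x := by rw [hx]; field_simp
    have hl : ((N - s : ℕ) : ℝ) = N * (1 - x) := by rw [one_sub_x]; field_simp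
    rw [binRelEntropy, hl, hs']
    ring
  have success : x ^ s * (2 : ℝ) ^ (-(s * Real.logb 2 (x / p))) = p ^ s :=
    pow_mul_two_rpow_neg_mul_logb_div hp0 fun hs0 => by positivity
  have failure : (1 - x) ^ (N - s) *
      (2 : ℝ) ^ (-((N - s : ℕ) * Real.logb 2 ((1 - x) / (1 - p)))) = (1 - p) ^ (N - s) :=
    pow_mul_two_rpow_neg_mul_logb_div (sub_pos.mpr hp1) fun hs0 => by rw [one_sub_x]; positivity
  calc (2 : ℝ) ^ (-(N * binRelEntropy x p))
      ≤ (N + 1 : ℝ) * (N.choose s * (x ^ s * (1 - x) ^ (N - s))) *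
          (2 : ℝ) ^ (-(N * binRelEntropy x p)) :=
        le_mul_of_one_le_left (by positivity) (one_le_choose_mul_div_pow hs)
    _ = _ := by
        rw [exponent, Real.rpow_add two_pos, ← success, ← failure]
        ring

lemma tendsto_logb_add_one_div :
    Tendsto (fun N : ℕ => Real.logb 2 (N + 1) / N) atTop (𝓝 0) := by
  have := ((Real.tendsto_pow_log_div_mul_add_atTop 1 (-1) 1 one_ne_zero).comp
    (tendsto_atTop_add_const_right atTop (1 : ℝ) tendsto_natCast_atTop_atTop)).div_const
      (Real.log 2)
  rw [zero_div] at this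
  refine this.congr fun N => ?_
  simp only [Function.comp_apply, Real.logb]
  ring

lemma exists_tendsto_two_rpow_le_binomial (hp0 : 0 < p) (hp1 : p < 1)
    (hx : x ∈ Set.Icc (0 : ℝ) 1) :
    ∃ a : ℕ → ℝ, Tendsto (fun N => a N / N) atTop (𝓝 (-binRelEntropy x p)) ∧ ∀ N : ℕ,
      (2 : ℝ) ^ a N ≤ N.choose ⌊x * N⌋₊ * p ^ ⌊x * N⌋₊ * (1 - p) ^ (N - ⌊x * N⌋₊) := by
  refine ⟨fun N => -(N * binRelEntropy (⌊x * N⌋₊ / N) p) - Real.logb 2 (N + 1), ?_, fun N => ?_⟩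
  · have frequency : Tendsto (fun N : ℕ => (⌊x * N⌋₊ : ℝ) / N) atTop (𝓝 x) :=
      (tendsto_nat_floor_mul_div_atTop hx.1).comp tendsto_natCast_atTop_atTop
    have rate := (((continuous_binRelEntropy hp0 hp1).tendsto x).comp frequency).neg.sub
      tendsto_logb_add_one_div
    rw [sub_zero] at rate
    refine rate.congr' ((eventually_ne_atTop 0).mono fun N hN => ?_)
    have : (N : ℝ) ≠ 0 := Nat.cast_ne_zero.mpr hN
    simp only [Function.comp_apply]
    field_simp
  · have floor_le : ⌊x * N⌋₊ ≤ N :=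
      Nat.floor_le_of_le (mul_le_of_le_one_left N.cast_nonneg hx.2)
    rw [Real.rpow_sub two_pos, Real.rpow_logb two_pos one_lt_two.ne' (by positivity),
      div_le_iff₀' (by positivity)]
    exact two_rpow_neg_mul_binRelEntropy_le hp0 hp1 floor_le

end BinaryRelativeEntropy

section Achievability

open Filter Topology Asymptotics

variable {S T : Sys k} {ψ : S.H} {φ : T.H} {p q R r : ℝ}

lemma isLittleO_sub_const_mul_natCast_iff {f : ℕ → ℝ} {c : ℝ} :
    (fun n : ℕ => f n - c * n) =o[atTop] (fun n : ℕ => (n : ℝ)) ↔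
      Tendsto (fun n : ℕ => f n / n) atTop (𝓝 c) := by
  have ne_zero : ∀ᶠ n : ℕ in atTop, (n : ℝ) ≠ 0 :=
    (eventually_ne_atTop 0).mono fun n => Nat.cast_ne_zero.mpr
  rw [isLittleO_iff_tendsto' (ne_zero.mono fun n hn h => absurd h hn)]
  exact (tendsto_congr' (ne_zero.mono fun n hn => by field_simp)).trans tendsto_sub_nhds_zero_iff

lemma achievable_iff_tendsto :
    Achievable ψ φ R r ↔ 0 ≤ R ∧ 0 ≤ r ∧ ∃ (M : ℕ → ℕ) (a : ℕ → ℝ),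
      Tendsto (fun n : ℕ => (M n : ℝ) / n) atTop (𝓝 R) ∧
      Tendsto (fun n : ℕ => a n / n) atTop (𝓝 (-r)) ∧
      ∀ n, ∃ p : ℝ, (2 : ℝ) ^ a n ≤ p ∧ Transforms (powVec ψ n) (powVec φ (M n)) p := by
  simp only [Achievable, ← isLittleO_sub_const_mul_natCast_iff]
  refine and_congr_right fun _ => and_congr_right fun _ => exists_congr fun M => ⟨?_, ?_⟩
  · rintro ⟨e, hM, he, h⟩
    exact ⟨fun n => -r * n + e n, hM, by simpa only [add_sub_cancel_left] using he, h⟩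
  · rintro ⟨a, hM, ha, h⟩
    exact ⟨fun n => a n - -r * n, hM, ha, by simpa only [add_sub_cancel] using h⟩

lemma exists_tendsto_two_rpow_le_binomial_max (hp : p ∈ Set.Icc (0 : ℝ) 1)
    (hq : q ∈ Set.Icc (0 : ℝ) 1) (hpq : 0 < p ∨ q = 0) :
    0 ≤ binRelEntropy (max p q) p ∧
      ∃ a : ℕ → ℝ, Tendsto (fun N => a N / N) atTop (𝓝 (-binRelEntropy (max p q) p)) ∧ ∀ N : ℕ,
        (2 : ℝ) ^ a N ≤ N.choose ⌊max p q * N⌋₊ * p ^ ⌊max p q * N⌋₊ *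
          (1 - p) ^ (N - ⌊max p q * N⌋₊) := by
  rcases hp.1.eq_or_lt with rfl | hp0
  · obtain rfl : q = 0 := hpq.resolve_left (lt_irrefl 0)
    rw [max_self, binRelEntropy_self]
    exact ⟨le_rfl, 0, by simp, by simp⟩
  rcases hp.2.eq_or_lt with rfl | hp1
  · rw [max_eq_left hq.2, binRelEntropy_self]
    exact ⟨le_rfl, 0, by simp, by simp⟩
  have hx : max p q ∈ Set.Icc (0 : ℝ) 1 := ⟨le_max_of_le_left hp.1, max_le hp.2 hq.2⟩
  exact ⟨binRelEntropy_nonneg hp0 hp1 hx, exists_tendsto_two_rpow_le_binomial hp0 hp1 hx⟩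

lemma Transforms.achievable [NeZero k] (hψ : ‖ψ‖ = 1) (hφ : ‖φ‖ = 1) (h : Transforms ψ φ p)
    (hp : p ∈ Set.Icc (0 : ℝ) 1) (hq : q ∈ Set.Icc (0 : ℝ) 1) (hpq : 0 < p ∨ q = 0) :
    Achievable ψ φ q (binRelEntropy (max p q) p) := by
  obtain ⟨nonneg, a, ha, prob_le⟩ := exists_tendsto_two_rpow_le_binomial_max hp hq hpq
  refine achievable_iff_tendsto.mpr ⟨hq.1, nonneg, fun N => ⌊q * N⌋₊, a,
    (tendsto_nat_floor_mul_div_atTop hq.1).comp tendsto_natCast_atTop_atTop, ha,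
    fun N => ⟨_, prob_le N, ?_⟩⟩
  have floor_le : ⌊q * N⌋₊ ≤ ⌊max p q * N⌋₊ :=
    Nat.floor_le_floor (mul_le_mul_of_nonneg_right (le_max_right p q) N.cast_nonneg)
  simpa using (h.powVec hψ hφ N _).trans (by rw [norm_powVec, hφ, one_pow])
    (powVec_of_le hφ floor_le)

lemma tendsto_natDiv_div {n : ℕ} (hn : 0 < n) {f : ℕ → ℝ} {c : ℝ}
    (hf : Tendsto (fun N : ℕ => f N / N) atTop (𝓝 c)) :
    Tendsto (fun L : ℕ => f (L / n) / L) atTop (𝓝 (c / n)) := by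
  have blocks : Tendsto (fun L : ℕ => ((L / n : ℕ) : ℝ) / L) atTop (𝓝 (1 / n)) := by
    refine ((tendsto_nat_floor_mul_div_atTop (a := 1 / (n : ℝ)) (by positivity)).comp
      tendsto_natCast_atTop_atTop).congr fun L => ?_
    rw [Function.comp_apply, one_div_mul_eq_div, Nat.floor_div_eq_div]
  have natDiv : Tendsto (fun L : ℕ => L / n) atTop atTop := Nat.tendsto_div_const_atTop hn.ne'
  have mul := (hf.comp natDiv).mul blocks
  rw [mul_one_div] at mul
  refine mul.congr' ((natDiv.eventually_ne_atTop 0).mono fun L hL => ?_)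
  exact div_mul_div_cancel₀ (Nat.cast_ne_zero.mpr hL)

lemma Achievable.of_powVec [NeZero k] (hψ : ‖ψ‖ = 1) (hφ : ‖φ‖ = 1) {m n : ℕ} (hn : 0 < n)
    (h : Achievable (powVec ψ n) (powVec φ m) R r) : Achievable ψ φ (R * (m / n)) (r / n) := by
  obtain ⟨hR, hr, M, a, hM, ha, h⟩ := achievable_iff_tendsto.mp h
  refine achievable_iff_tendsto.mpr ⟨by positivity, by positivity, fun L => M (L / n) * m,
    fun L => a (L / n), ?_, ?_, fun L => ?_⟩
  · rw [← mul_div_assoc, mul_div_right_comm]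
    refine ((tendsto_natDiv_div hn hM).mul_const (m : ℝ)).congr fun L => ?_
    push_cast
    ring
  · simpa only [neg_div] using tendsto_natDiv_div hn ha
  · obtain ⟨p, hp, h⟩ := h (L / n)
    refine ⟨p, hp, ?_⟩
    have blocks : Transforms (powVec ψ L) (powVec (powVec ψ n) (L / n)) 1 :=
      (Transforms.powVec_of_le hψ (Nat.div_mul_le_self L n)).relabel_right
        (by rw [norm_powVec, hψ, one_pow]) (relabels_powVec_powVec ψ n (L / n)).symm
    simpa using (blocks.trans (by simp [norm_powVec, hψ]) h).relabel_right
      (by simp [norm_powVec, hφ]) (relabels_powVec_powVec φ m (M (L / n)))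

end Achievability

section BlockInclusions

variable {Ω Y : Type*} {X : Ω → Type*} [Fintype Ω] [DecidableEq Ω] [∀ ω, Fintype (X ω)]
  [∀ ω, DecidableEq (X ω)]

/-- The inclusion of the summand `ω` into the direct sum of the spaces `ℂ^(X ω)`. -/
def blockInclusion (X : Ω → Type*) [∀ ω, DecidableEq (X ω)] (ω : Ω) :
    Matrix (Σ ω, X ω) (X ω) ℂ :=
  (1 : Matrix (Σ ω, X ω) (Σ ω, X ω) ℂ).submatrix id (Sigma.mk ω)

lemma blockInclusion_conjTranspose_mul (ω η : Ω) :
    (blockInclusion X ω)ᴴ * blockInclusion X η =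
      (1 : Matrix (Σ ω, X ω) (Σ ω, X ω) ℂ).submatrix (Sigma.mk ω) (Sigma.mk η) := by
  rw [blockInclusion, blockInclusion, Matrix.conjTranspose_submatrix, Matrix.conjTranspose_one,
    ← Matrix.submatrix_mul _ _ _ _ _ Function.bijective_id, one_mul]

lemma blockInclusion_conjTranspose_mul_self (ω : Ω) :
    (blockInclusion X ω)ᴴ * blockInclusion X ω = 1 := by
  rw [blockInclusion_conjTranspose_mul, Matrix.submatrix_one _ sigma_mk_injective]

lemma blockInclusion_conjTranspose_mul_of_ne {ω η : Ω} (h : ω ≠ η) :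
    (blockInclusion X ω)ᴴ * blockInclusion X η = 0 := by
  rw [blockInclusion_conjTranspose_mul]
  ext x y
  exact Matrix.one_apply_ne fun h' => h (congrArg Sigma.fst h')

lemma blockInclusion_conjTranspose_mul_sum (K : ∀ ω, Matrix (X ω) Y ℂ) (ω : Ω) :
    (blockInclusion X ω)ᴴ * ∑ η, blockInclusion X η * K η = K ω := by
  rw [Matrix.mul_sum, Finset.sum_eq_single ω, ← Matrix.mul_assoc,
    blockInclusion_conjTranspose_mul_self, Matrix.one_mul]
  · intro η _ h
    rw [← Matrix.mul_assoc, blockInclusion_conjTranspose_mul_of_ne h.symm, Matrix.zero_mul]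
  · exact fun h => absurd (Finset.mem_univ ω) h

lemma sum_blockInclusion_conjTranspose_mul_self (K : ∀ ω, Matrix (X ω) Y ℂ) :
    (∑ ω, blockInclusion X ω * K ω)ᴴ * ∑ ω, blockInclusion X ω * K ω = ∑ ω, (K ω)ᴴ * K ω := by
  simp only [Matrix.conjTranspose_sum, Matrix.conjTranspose_mul, Matrix.sum_mul, Matrix.mul_assoc,
    blockInclusion_conjTranspose_mul_sum]

lemma orthogonalIdempotents_blockInclusion :
    OrthogonalIdempotents fun ω : Ω => blockInclusion X ω * (blockInclusion X ω)ᴴ where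
  idem ω := by
    rw [IsIdempotentElem, Matrix.mul_assoc, ← Matrix.mul_assoc _ _ (_ᴴ),
      blockInclusion_conjTranspose_mul_self, Matrix.one_mul]
  ortho ω η h := by
    change _ * _ = 0
    rw [Matrix.mul_assoc, ← Matrix.mul_assoc _ _ (_ᴴ),
      blockInclusion_conjTranspose_mul_of_ne h, Matrix.zero_mul, Matrix.mul_zero]

end BlockInclusions

section SpectralPoints

lemma siteApply_localApply {S T : Sys k} (j : Fin k) (P : Matrix (T.idx j) (T.idx j) ℂ)
    (A : ∀ i, Matrix (T.idx i) (S.idx i) ℂ) (ψ : S.H) :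
    siteApply j P (localApply A ψ) = localApply (Function.update A j (P * A j)) ψ := by
  rw [siteApply, localApply_localApply]
  congr 1
  funext i
  rcases eq_or_ne i j with rfl | hi
  · simp only [Function.update_self]
  · simp only [Function.update_of_ne hi, Matrix.one_mul]

lemma siteApply_siteApply {S : Sys k} (j : Fin k) (P Q : Matrix (S.idx j) (S.idx j) ℂ) (ψ : S.H) :
    siteApply j P (siteApply j Q ψ) = siteApply j (P * Q) ψ := by
  rw [siteApply.eq_def j Q, siteApply_localApply, Function.update_idem, Function.update_self,
    siteApply]

/-- The functional does not increase on average under local measurements. -/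
def IsEnsembleMonotone (G : Functional k) : Prop :=
  ∀ ⦃Ω : Type⦄ [Fintype Ω] ⦃S : Sys k⦄ ⦃S' : Ω → Sys k⦄ ⦃j : Fin k⦄
    ⦃A : ∀ ω i, Matrix ((S' ω).idx i) (S.idx i) ℂ⦄, IsLocalMeasurement j A →
    ∀ ψ, ∑ ω, G (S' ω) (localApply (A ω) ψ) ≤ G S ψ

lemma IsEnsembleMonotone.prob_mul_add_le {G : Functional k} (hG : IsEnsembleMonotone G)
    {S T : Sys k} {φ : T.H} {c d : ℝ} (hc : ∀ z : ℂ, ‖z • φ‖ ^ 2 * c ≤ G T (z • φ))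
    (hd : ∀ (S : Sys k) (ψ : S.H), ‖ψ‖ ^ 2 * d ≤ G S ψ) (P : Protocol T S) (ψ : S.H)
    (h : P.Aligned φ ψ) : P.prob ψ * c + (‖ψ‖ ^ 2 - P.prob ψ) * d ≤ G S ψ := by
  induction P with
  | success =>
    obtain ⟨z, rfl⟩ := h
    simpa only [Protocol.prob_success, sub_self, zero_mul, add_zero] using hc z
  | failure S =>
    simpa only [Protocol.prob_failure, sub_zero, zero_mul, zero_add] using hd S ψ
  | round S j N S' A isometry complete next ih =>
    have hA : IsLocalMeasurement j A := ⟨isometry, complete⟩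
    refine le_trans ?_ (hG hA ψ)
    rw [Protocol.prob_round hA, ← hA.sum_norm_sq ψ, ← Finset.sum_sub_distrib, Finset.sum_mul,
      Finset.sum_mul, ← Finset.sum_add_distrib]
    exact Finset.sum_le_sum fun ω _ => ih ω _ (h ω)

lemma IsEnsembleMonotone.le_of_transforms {G : Functional k} (hG : IsEnsembleMonotone G)
    {S T : Sys k} {ψ : S.H} {φ : T.H} {c d p : ℝ} (hφ : ‖φ‖ = 1)
    (hc : ∀ z : ℂ, ‖z • φ‖ ^ 2 * c ≤ G T (z • φ))
    (hd : ∀ (S : Sys k) (ψ : S.H), ‖ψ‖ ^ 2 * d ≤ G S ψ) (h : Transforms ψ φ p) :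
    p * c + (‖ψ‖ ^ 2 - p) * d ≤ G S ψ := by
  obtain ⟨P, hP⟩ := h
  simpa only [Protocol.prob_eq_of_output_eq hφ hP] using
    hG.prob_mul_add_le hc hd P ψ (Protocol.aligned_of_output_eq hP)

namespace IsSpectralPoint

variable {α : ℝ} {F : Functional k} {S T : Sys k} {ψ : S.H} {φ : T.H}

lemma map_relabels (hF : IsSpectralPoint α F) (h : Relabels ψ φ) : F T φ = F S ψ := by
  obtain ⟨V, hV, rfl⟩ := h.exists_isometry
  exact hF.isometry_invariant S T V ψ hV

lemma map_unitVec_one (hF : IsSpectralPoint α F) : F (Sys.diag k 1) (unitVec k 1) = 1 :=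
  (hF.unit 1).trans Nat.cast_one

lemma map_powVec (hF : IsSpectralPoint α F) (ψ : S.H) (n : ℕ) :
    F (S.pow n) (powVec ψ n) = F S ψ ^ n := by
  induction n with
  | zero => rw [← hF.map_relabels (relabels_powVec_zero ψ), hF.map_unitVec_one, pow_zero]
  | succ n ih =>
    rw [← hF.map_relabels (relabels_powVec_succ ψ n), hF.multiplicative, ih, pow_succ']

lemma map_smul_of_norm_eq_one [NeZero k] (hF : IsSpectralPoint α F) {z : ℂ} (hz : ‖z‖ = 1)
    (ψ : S.H) : F S (z • ψ) = F S ψ := by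
  rw [← localApply_update_smul_one 0 z ψ]
  refine hF.isometry_invariant S S _ ψ fun i => ?_
  rcases eq_or_ne i 0 with rfl | hi
  · rw [Function.update_self, Matrix.conjTranspose_smul, Matrix.conjTranspose_one,
      smul_mul_smul_comm, Matrix.one_mul, RCLike.star_def, Complex.conj_mul', hz]
    simp only [Complex.ofReal_one, one_pow, one_smul]
  · rw [Function.update_of_ne hi, Matrix.conjTranspose_one, Matrix.one_mul]

lemma map_smul [NeZero k] (hF : IsSpectralPoint α F) {z : ℂ} (hz : z ≠ 0) (ψ : S.H) :
    F S (z • ψ) = (‖z‖ ^ 2) ^ α * F S ψ := by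
  have hz' : (‖z‖ : ℂ) ≠ 0 := Complex.ofReal_ne_zero.mpr (norm_ne_zero_iff.mpr hz)
  have phase : ‖z / ‖z‖‖ = 1 := by
    rw [norm_div, Complex.norm_real, norm_norm, div_self (norm_ne_zero_iff.mpr hz)]
  have polar : z • ψ = ((Real.sqrt (‖z‖ ^ 2) : ℝ) : ℂ) • (z / ‖z‖) • ψ := by
    rw [Real.sqrt_sq (norm_nonneg z), smul_smul, mul_div_cancel₀ _ hz']
  rw [polar, hF.scaling _ _ _ (by positivity), hF.map_smul_of_norm_eq_one phase]

lemma norm_sq_mul_rpow_le_map_smul [NeZero k] (hF : IsSpectralPoint α F) (hα : α ≠ 0)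
    (hφ : ‖φ‖ = 1) (z : ℂ) : ‖z • φ‖ ^ 2 * F T φ ^ (1 / α) ≤ F T (z • φ) ^ (1 / α) := by
  rw [norm_smul, hφ, mul_one]
  rcases eq_or_ne z 0 with rfl | hz
  · simpa using Real.rpow_nonneg (hF.nonneg _ _) _
  · rw [hF.map_smul hz, Real.mul_rpow (by positivity) (hF.nonneg _ _),
      ← Real.rpow_mul (by positivity), mul_one_div_cancel hα, Real.rpow_one]

lemma sum_rpow_siteApply_le (hF : IsSpectralPoint α F) (hα : α ≠ 0) {Ω : Type*} {j : Fin k}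
    {P : Ω → Matrix (S.idx j) (S.idx j) ℂ} (hP : OrthogonalIdempotents P)
    (hermitian : ∀ ω, (P ω).IsHermitian) (s : Finset Ω) (ψ : S.H) :
    ∑ ω ∈ s, F S (siteApply j (P ω) ψ) ^ (1 / α) ≤ F S ψ ^ (1 / α) := by
  classical
  induction s using Finset.induction_on generalizing ψ with
  | empty => simpa only [Finset.sum_empty] using Real.rpow_nonneg (hF.nonneg S ψ) _
  | insert ω s hω ih =>
    have absorb : ∀ η ∈ s,
        siteApply j (P η) (siteApply j (1 - P ω) ψ) = siteApply j (P η) ψ := fun η hη => by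
      rw [siteApply_siteApply, Matrix.mul_sub, Matrix.mul_one,
        hP.ortho (ne_of_mem_of_not_mem hη hω), sub_zero]
    have split := hF.projection S ψ j (P ω) (hermitian ω) (hP.idem ω)
    rw [if_neg hα] at split
    rw [Finset.sum_insert hω]
    refine le_trans (add_le_add_right ?_ _) split
    refine (Finset.sum_congr rfl fun η hη => ?_).trans_le (ih (siteApply j (1 - P ω) ψ))
    rw [absorb η hη]

/-- Any two isometries `C i : ℂ^(S.idx i) → ℂ^(T.idx i)` become the inclusion of the second summand
after the isometry `(1 - C i (C i)ᴴ) ⊕ (C i)ᴴ`, so the choice of `C i` cannot matter. -/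
lemma map_localApply_congr (hF : IsSpectralPoint α F) {j : Fin k}
    {A B : ∀ i, Matrix (T.idx i) (S.idx i) ℂ} (hA : ∀ i ≠ j, (A i)ᴴ * A i = 1)
    (hB : ∀ i ≠ j, (B i)ᴴ * B i = 1) (h : A j = B j) (ψ : S.H) :
    F T (localApply A ψ) = F T (localApply B ψ) := by
  let canonical : ∀ i, Matrix (T.idx i ⊕ S.idx i) (S.idx i) ℂ :=
    Function.update (fun i => Matrix.fromRows 0 1) j (Matrix.fromRows (A j) 0)
  suffices key : ∀ C : ∀ i, Matrix (T.idx i) (S.idx i) ℂ, (∀ i ≠ j, (C i)ᴴ * C i = 1) →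
      C j = A j → F T (localApply C ψ) = F (T.sum S) (localApply canonical ψ) from
    (key A hA rfl).trans (key B hB h.symm).symm
  intro C hC hj
  let Z : ∀ i, Matrix (T.idx i ⊕ S.idx i) (T.idx i) ℂ :=
    Function.update (fun i => Matrix.fromRows (1 - C i * (C i)ᴴ) (C i)ᴴ) j (Matrix.fromRows 1 0)
  have isometry : ∀ i, (Z i)ᴴ * Z i = 1 := fun i => by
    rcases eq_or_ne i j with rfl | hi
    · simp only [Z, Function.update_self, Matrix.conjTranspose_fromRows_eq_fromCols_conjTranspose,
        Matrix.fromCols_mul_fromRows, Matrix.conjTranspose_one, Matrix.conjTranspose_zero,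
        Matrix.one_mul, Matrix.mul_zero, add_zero]
    · have idem : C i * (C i)ᴴ * (C i * (C i)ᴴ) = C i * (C i)ᴴ := by
        rw [Matrix.mul_assoc, ← Matrix.mul_assoc _ _ (_ᴴ), hC i hi, Matrix.one_mul]
      simp only [Z, Function.update_of_ne hi,
        Matrix.conjTranspose_fromRows_eq_fromCols_conjTranspose, Matrix.fromCols_mul_fromRows,
        Matrix.conjTranspose_sub, Matrix.conjTranspose_one, Matrix.conjTranspose_mul,
        Matrix.conjTranspose_conjTranspose, Matrix.mul_sub, Matrix.sub_mul, Matrix.mul_one,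
        Matrix.one_mul, idem]
      abel
  have mul_eq : ∀ i, Z i * C i = canonical i := fun i => by
    rcases eq_or_ne i j with rfl | hi
    · simp only [Z, canonical, Function.update_self, Matrix.fromRows_mul, Matrix.one_mul,
        Matrix.zero_mul, hj]
    · simp only [Z, canonical, Function.update_of_ne hi, Matrix.fromRows_mul, Matrix.sub_mul,
        Matrix.one_mul, Matrix.mul_assoc, hC i hi, Matrix.mul_one, sub_self]
  rw [← hF.isometry_invariant T (T.sum S) Z _ isometry, localApply_localApply]
  exact congrArg (fun D => F (T.sum S) (localApply D ψ)) (funext mul_eq)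

lemma exists_projective_measurement (hF : IsSpectralPoint α F) {Ω : Type} [Fintype Ω] [Nonempty Ω]
    {S' : Ω → Sys k} {j : Fin k} {A : ∀ ω i, Matrix ((S' ω).idx i) (S.idx i) ℂ}
    (hA : IsLocalMeasurement j A) (ψ : S.H) :
    ∃ (R : Sys k) (χ : R.H) (P : Ω → Matrix (R.idx j) (R.idx j) ℂ),
      OrthogonalIdempotents P ∧ (∀ ω, (P ω).IsHermitian) ∧ F R χ = F S ψ ∧
        ∀ ω, F R (siteApply j (P ω) χ) = F (S' ω) (localApply (A ω) ψ) := by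
  classical
  let R : Sys k := { idx := fun i => Σ ω, (S' ω).idx i }
  let W : ∀ ω i, Matrix (R.idx i) ((S' ω).idx i) ℂ := fun ω i =>
    blockInclusion (fun ω => (S' ω).idx i) ω
  let ω₀ : Ω := Classical.arbitrary Ω
  -- The Naimark dilation of the measurement; the isometries of the other parties are arbitrary.
  let V : ∀ i, Matrix (R.idx i) (S.idx i) ℂ :=
    Function.update (fun i => W ω₀ i * A ω₀ i) j (∑ ω, W ω j * A ω j)
  have isometry_W : ∀ ω i, (W ω i)ᴴ * W ω i = 1 := fun ω i =>
    blockInclusion_conjTranspose_mul_self ω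
  have isometry_mul : ∀ ω, ∀ i ≠ j, (W ω i * A ω i)ᴴ * (W ω i * A ω i) = 1 := fun ω i hi => by
    rw [Matrix.conjTranspose_mul, Matrix.mul_assoc, ← Matrix.mul_assoc _ (W ω i), isometry_W,
      Matrix.one_mul, hA.isometry ω i hi]
  have isometry_V : ∀ i, (V i)ᴴ * V i = 1 := fun i => by
    rcases eq_or_ne i j with rfl | hi
    · simp only [V, Function.update_self]
      exact (sum_blockInclusion_conjTranspose_mul_self fun ω => A ω i).trans hA.complete
    · simpa only [V, Function.update_of_ne hi] using isometry_mul ω₀ i hi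
  refine ⟨R, localApply V ψ, fun ω => W ω j * (W ω j)ᴴ, orthogonalIdempotents_blockInclusion,
    fun ω => Matrix.isHermitian_mul_conjTranspose_self _, hF.isometry_invariant _ _ V ψ isometry_V,
    fun ω => ?_⟩
  have outcome : W ω j * (W ω j)ᴴ * V j = W ω j * A ω j := by
    simp only [V, Function.update_self, Matrix.mul_assoc]
    exact congrArg _ (blockInclusion_conjTranspose_mul_sum (fun ω => A ω j) ω)
  rw [siteApply_localApply, outcome, ← hF.isometry_invariant _ R (W ω) _ (isometry_W ω),
    localApply_localApply]
  refine hF.map_localApply_congr (j := j) (fun i hi => ?_) (isometry_mul ω)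
    (Function.update_self _ _ _) ψ
  rw [Function.update_of_ne hi, isometry_V]

lemma isEnsembleMonotone_rpow (hF : IsSpectralPoint α F) (hα : α ≠ 0) :
    IsEnsembleMonotone fun S ψ => F S ψ ^ (1 / α) := by
  intro Ω _ S S' j A hA ψ
  rcases isEmpty_or_nonempty Ω with _ | _
  · simpa only [Finset.univ_eq_empty, Finset.sum_empty] using Real.rpow_nonneg (hF.nonneg S ψ) _
  obtain ⟨R, χ, P, hP, hermitian, map_χ, map_outcome⟩ := hF.exists_projective_measurement hA ψ
  simpa only [map_χ, map_outcome] using hF.sum_rpow_siteApply_le hα hP hermitian Finset.univ χ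

lemma norm_sq_le_rpow [NeZero k] (hF : IsSpectralPoint α F) (hα : α ≠ 0) (ψ : S.H) :
    ‖ψ‖ ^ 2 ≤ F S ψ ^ (1 / α) := by
  simpa only [hF.map_unitVec_one, Real.one_rpow, mul_one, mul_zero, add_zero] using
    (hF.isEnsembleMonotone_rpow hα).le_of_transforms (d := 0) norm_unitVec_one
      (hF.norm_sq_mul_rpow_le_map_smul hα norm_unitVec_one)
      (fun S ψ => by simpa only [mul_zero] using Real.rpow_nonneg (hF.nonneg S ψ) _)
      (Transforms.to_unitVec_one ψ)

lemma le_of_transforms [NeZero k] (hF : IsSpectralPoint α F) (hα : α ≠ 0) (hψ : ‖ψ‖ = 1)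
    (hφ : ‖φ‖ = 1) {p : ℝ} (h : Transforms ψ φ p) :
    p * F T φ ^ (1 / α) + (1 - p) ≤ F S ψ ^ (1 / α) := by
  simpa only [hψ, one_pow, mul_one] using
    (hF.isEnsembleMonotone_rpow hα).le_of_transforms (d := 1) hφ
      (hF.norm_sq_mul_rpow_le_map_smul hα hφ)
      (fun S ψ => by simpa only [mul_one] using hF.norm_sq_le_rpow hα ψ) h

lemma map_outcome_le_of_zero (hF : IsSpectralPoint 0 F) {Ω : Type} [Fintype Ω]
    {S' : Ω → Sys k} {j : Fin k} {A : ∀ ω i, Matrix ((S' ω).idx i) (S.idx i) ℂ}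
    (hA : IsLocalMeasurement j A) (ψ : S.H) (ω : Ω) :
    F (S' ω) (localApply (A ω) ψ) ≤ F S ψ := by
  have : Nonempty Ω := ⟨ω⟩
  obtain ⟨R, χ, P, hP, hermitian, map_χ, map_outcome⟩ := hF.exists_projective_measurement hA ψ
  have split := hF.projection R χ j (P ω) (hermitian ω) (hP.idem ω)
  rw [if_pos rfl, map_outcome, map_χ] at split
  exact (le_max_left _ _).trans split

lemma le_of_aligned_of_zero [NeZero k] (hF : IsSpectralPoint 0 F) (P : Protocol T S) (ψ : S.H)
    (h : P.Aligned φ ψ) (hp : 0 < P.prob ψ) : F T φ ≤ F S ψ := by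
  induction P with
  | success =>
    obtain ⟨z, rfl⟩ := h
    have hz : z ≠ 0 := by
      rintro rfl
      simp [Protocol.prob_success] at hp
    rw [hF.map_smul hz, Real.rpow_zero, one_mul]
  | failure S => exact absurd hp (Protocol.prob_failure ψ).not_gt
  | round S j N S' A isometry complete next ih =>
    have hA : IsLocalMeasurement j A := ⟨isometry, complete⟩
    rw [Protocol.prob_round hA] at hp
    obtain ⟨ω, -, hω⟩ := Finset.exists_lt_of_sum_lt (Finset.sum_const_zero.trans_lt hp)
    exact (ih ω _ (h ω) hω).trans (hF.map_outcome_le_of_zero hA ψ ω)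

lemma le_of_transforms_of_zero [NeZero k] (hF : IsSpectralPoint 0 F) (hφ : ‖φ‖ = 1) {p : ℝ}
    (hp : 0 < p) (h : Transforms ψ φ p) : F T φ ≤ F S ψ := by
  obtain ⟨P, hP⟩ := h
  exact hF.le_of_aligned_of_zero P ψ (Protocol.aligned_of_output_eq hP)
    (by rwa [Protocol.prob_eq_of_output_eq hφ hP])

lemma pos [NeZero k] (hF : IsSpectralPoint α F) (hψ : ψ ≠ 0) : 0 < F S ψ := by
  refine (hF.nonneg S ψ).lt_of_ne' fun eq_zero => ?_
  have norm_pos : 0 < ‖ψ‖ ^ 2 := by positivity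
  rcases eq_or_ne α 0 with rfl | hα
  · have := hF.le_of_transforms_of_zero norm_unitVec_one norm_pos (Transforms.to_unitVec_one ψ)
    rw [hF.map_unitVec_one, eq_zero] at this
    exact zero_lt_one.not_ge this
  · have := hF.norm_sq_le_rpow hα ψ
    rw [eq_zero, Real.zero_rpow (one_div_ne_zero hα)] at this
    exact norm_pos.not_ge this

end IsSpectralPoint

end SpectralPoints

section LogSpectralPoints

open Filter Topology

variable {E : Functional k} {S T : Sys k} {ψ : S.H} {φ : T.H} {α p : ℝ}

lemma powVec_ne_zero (hψ : ψ ≠ 0) (n : ℕ) : powVec ψ n ≠ 0 := by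
  rw [← norm_ne_zero_iff, norm_powVec]
  exact pow_ne_zero n (norm_ne_zero_iff.mpr hψ)

namespace IsLogSpectralPoint

lemma map_powVec (hE : IsLogSpectralPoint α E) (hψ : ψ ≠ 0) (n : ℕ) :
    E (S.pow n) (powVec ψ n) = n * E S ψ := by
  obtain ⟨-, F, hF, eq_logb⟩ := hE
  rw [eq_logb _ _ (powVec_ne_zero hψ n), eq_logb _ _ hψ, hF.map_powVec, Real.logb_pow,
    mul_div_assoc]

lemma le_of_transforms [NeZero k] (hE : IsLogSpectralPoint α E) (hα : 0 < α) (hψ : ‖ψ‖ = 1)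
    (hφ : ‖φ‖ = 1) (hp : p ∈ Set.Icc (0 : ℝ) 1) (h : Transforms ψ φ p) :
    α / (1 - α) * Real.logb 2 (p * (2 : ℝ) ^ ((1 - α) / α * E T φ) + (1 - p)) ≤ E S ψ := by
  obtain ⟨hα1, F, hF, eq_logb⟩ := hE
  have hψ0 : ψ ≠ 0 := ne_zero_of_norm_ne_zero (hψ.trans_ne one_ne_zero)
  have hφ0 : φ ≠ 0 := ne_zero_of_norm_ne_zero (hφ.trans_ne one_ne_zero)
  have one_sub_pos : 0 < 1 - α := sub_pos.mpr hα1
  have two_rpow : (2 : ℝ) ^ ((1 - α) / α * E T φ) = F T φ ^ (1 / α) := by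
    have exponent : (1 - α) / α * E T φ = Real.logb 2 (F T φ) * (1 / α) := by
      rw [eq_logb T φ hφ0]
      field_simp
    rw [exponent, Real.rpow_mul zero_le_two, Real.rpow_logb two_pos one_lt_two.ne' (hF.pos hφ0)]
  have mean_pos : 0 < p * F T φ ^ (1 / α) + (1 - p) := by
    have := Real.rpow_pos_of_pos (hF.pos hφ0) (1 / α)
    rcases hp.1.eq_or_lt with rfl | hp0
    · simp
    · exact add_pos_of_pos_of_nonneg (mul_pos hp0 this) (sub_nonneg.mpr hp.2)
  have key := Real.logb_le_logb_of_le one_lt_two mean_pos (hF.le_of_transforms hα.ne' hψ hφ h)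
  rw [Real.logb_rpow_eq_mul_logb_of_pos (hF.pos hψ0)] at key
  calc α / (1 - α) * Real.logb 2 (p * (2 : ℝ) ^ ((1 - α) / α * E T φ) + (1 - p))
      ≤ α / (1 - α) * (1 / α * Real.logb 2 (F S ψ)) := by rw [two_rpow]; gcongr
    _ = E S ψ := by rw [eq_logb S ψ hψ0]; field_simp

lemma le_of_transforms_of_zero [NeZero k] (hE : IsLogSpectralPoint 0 E) (hψ : ‖ψ‖ = 1)
    (hφ : ‖φ‖ = 1) (hp : 0 < p) (h : Transforms ψ φ p) : E T φ ≤ E S ψ := by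
  obtain ⟨-, F, hF, eq_logb⟩ := hE
  have hψ0 : ψ ≠ 0 := ne_zero_of_norm_ne_zero (hψ.trans_ne one_ne_zero)
  have hφ0 : φ ≠ 0 := ne_zero_of_norm_ne_zero (hφ.trans_ne one_ne_zero)
  rw [eq_logb S ψ hψ0, eq_logb T φ hφ0, sub_zero, div_one, div_one]
  exact Real.logb_le_logb_of_le one_lt_two (hF.pos hφ0) (hF.le_of_transforms_of_zero hφ hp h)

end IsLogSpectralPoint

lemma mul_le_logb_mul_two_rpow_add (hp : p ∈ Set.Icc (0 : ℝ) 1) (x : ℝ) :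
    p * x ≤ Real.logb 2 (p * (2 : ℝ) ^ x + (1 - p)) := by
  have am_gm := Real.geom_mean_le_arith_mean2_weighted hp.1 (sub_nonneg.mpr hp.2)
    (Real.rpow_nonneg zero_le_two x) zero_le_one (add_sub_cancel p 1)
  rw [Real.one_rpow, mul_one, mul_one, ← Real.rpow_mul zero_le_two, mul_comm x p] at am_gm
  rwa [Real.le_logb_iff_rpow_le one_lt_two ((Real.rpow_pos_of_pos two_pos _).trans_le am_gm)]

namespace IsLogSpectralPointOne

lemma map_powVec (hE : IsLogSpectralPointOne E) (hψ : ‖ψ‖ = 1) (n : ℕ) :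
    E (S.pow n) (powVec ψ n) = n * E S ψ := by
  obtain ⟨l, _, isLogSpectralPoint, -, tendsto⟩ := hE
  refine tendsto_nhds_unique (tendsto _ _ (by rw [norm_powVec, hψ, one_pow]))
    (((tendsto S ψ hψ).const_mul (n : ℝ)).congr' ?_)
  filter_upwards [isLogSpectralPoint] with x hx
  exact (hx.2.map_powVec (ne_zero_of_norm_ne_zero (hψ.trans_ne one_ne_zero)) n).symm

lemma le_of_transforms [NeZero k] (hE : IsLogSpectralPointOne E) (hψ : ‖ψ‖ = 1) (hφ : ‖φ‖ = 1)
    (hp : p ∈ Set.Icc (0 : ℝ) 1) (h : Transforms ψ φ p) : p * E T φ ≤ E S ψ := by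
  obtain ⟨l, _, isLogSpectralPoint, -, tendsto⟩ := hE
  refine le_of_tendsto_of_tendsto ((tendsto T φ hφ).const_mul p) (tendsto S ψ hψ) ?_
  filter_upwards [isLogSpectralPoint] with ⟨α, E'⟩ ⟨hα, hE'⟩
  have hα0 : 0 < α := hα.1
  have one_sub_pos : 0 < 1 - α := sub_pos.mpr hα.2
  calc p * E' T φ = α / (1 - α) * (p * ((1 - α) / α * E' T φ)) := by field_simp
    _ ≤ α / (1 - α) * Real.logb 2 (p * (2 : ℝ) ^ ((1 - α) / α * E' T φ) + (1 - p)) := by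
        gcongr
        exact mul_le_logb_mul_two_rpow_add hp _
    _ ≤ E' S ψ := hE'.le_of_transforms hα0 hψ hφ hp h

end IsLogSpectralPointOne

end LogSpectralPoints

end

end LOCCSpectrum

theorem mainTheorem10 {k : ℕ} (hk : 2 ≤ k) {S T : Sys k} (ψ : S.H) (φ : T.H)
    (hψ : ‖ψ‖ = 1) (hφ : ‖φ‖ = 1) (m n : ℕ) (hn : 1 ≤ n)
    (p : ℝ) (hp : p ∈ Set.Icc (0 : ℝ) 1)
    (hLOCC : Transforms (powVec ψ n) (powVec φ m) p) :
    -- achievable pairs, whenever the exponent is finite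
    (∀ q ∈ Set.Icc (0 : ℝ) 1, (0 < p ∨ q = 0) →
      Achievable ψ φ (q * ((m : ℝ) / n)) (1 / (n : ℝ) * binRelEntropy (max p q) p)) ∧
    -- spectral points of order in (0, 1)
    (∀ α ∈ Set.Ioo (0 : ℝ) 1, ∀ E : Functional k, IsLogSpectralPoint α E →
      1 / (n : ℝ) * (α / (1 - α)) *
          Real.logb 2 (p * (2 : ℝ) ^ ((m : ℝ) * ((1 - α) / α) * E T φ) + (1 - p)) ≤ E S ψ) ∧
    -- order 0
    (0 < p → ∀ E : Functional k, IsLogSpectralPoint 0 E → (m : ℝ) / n * E T φ ≤ E S ψ) ∧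
    -- order 1
    (∀ E : Functional k, IsLogSpectralPointOne E → p * ((m : ℝ) / n) * E T φ ≤ E S ψ) := by
  have : NeZero k := ⟨by omega⟩
  have hψ' : ‖powVec ψ n‖ = 1 := by rw [norm_powVec, hψ, one_pow]
  have hφ' : ‖powVec φ m‖ = 1 := by rw [norm_powVec, hφ, one_pow]
  have hψ0 : ψ ≠ 0 := ne_zero_of_norm_ne_zero (hψ.trans_ne one_ne_zero)
  have hφ0 : φ ≠ 0 := ne_zero_of_norm_ne_zero (hφ.trans_ne one_ne_zero)
  have hn' : (0 : ℝ) < n := Nat.cast_pos.mpr hn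
  refine ⟨fun q hq hpq => ?_, fun α hα E hE => ?_, fun hp0 E hE => ?_, fun E hE => ?_⟩
  · rw [one_div_mul_eq_div]
    exact (hLOCC.achievable hψ' hφ' hp hq hpq).of_powVec hψ hφ hn
  · have single_shot := hE.le_of_transforms hα.1 hψ' hφ' hp hLOCC
    rw [hE.map_powVec hψ0, hE.map_powVec hφ0, mul_left_comm, ← mul_assoc (m : ℝ)] at single_shot
    rwa [mul_assoc, one_div_mul_eq_div, div_le_iff₀' hn']
  · have single_shot := hE.le_of_transforms_of_zero hψ' hφ' hp0 hLOCC
    rw [hE.map_powVec hψ0, hE.map_powVec hφ0] at single_shot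
    rwa [div_mul_eq_mul_div, div_le_iff₀' hn']
  · have single_shot := hE.le_of_transforms hψ' hφ' hp hLOCC
    rw [hE.map_powVec hψ, hE.map_powVec hφ] at single_shot
    rwa [mul_div_assoc', div_mul_eq_mul_div, div_le_iff₀' hn', mul_assoc]
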